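/- Let $\xi=(\xi_t)_{t\ge 0}$ be a real-valued Lévy process (with $\xi_0=0$ and càdlàg paths almost surely) on a probability space $(\Omega,\mathcal A,\mathbb P)$, with $\mathbb E|\xi_t|<\infty$ for all $t\ge 0$. For $0\le s<t$ put $\mathcal H_{s,t}=\sigma\{\xi_u : u\le s \text{ or } u\ge t\}$, and let $\overline{\mathcal H}_{s,t}$ be the $\sigma$-algebra generated by $\mathcal H_{s,t}$ and the events of probability zero. A two-parameter process $(M_{s,t})_{0\le s<t<\infty}$ is called a past-future martingale with respect to $(\overline{\mathcal H}_{s,t})$ if, for all $s<t$, $\mathbb E|M_{s,t}|<\infty$ and $M_{s,t}$ is $\overline{\mathcal H}_{s,t}$-measurable, and $\mathbb E[M_{s,t}\mid\overline{\mathcal H}_{r,u}]=M_{r,u}$ almost surely whenever $0\le r<s<t<u$. Let $f:[0,\infty)\to\mathbb R$ be a (deterministic) càdlàg function of locally finite variation with $\int_0^\infty|f(u)|\,du<\infty$; write $f(u-)$ for its left limit at $u>0$ and $f(0-)=f(0)$. For $0\le a\le b$, the stochastic integral $\int_a^b f(u-)\,d\xi_u$ (over $(a,b]$) is the limit in probability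 of the sums $\sum_i f(u_i-)(\xi_{u_{i+1}}-\xi_{u_i})$, and $[\xi,f]_t$ is the limit in probability of the sums $\sum_i(\xi_{u_{i+1}}-\xi_{u_i})(f(u_{i+1})-f(u_i))$, over partitions of $[a,b]$, respectively of $[0,t]$, as the mesh tends to $0$; $\int_a^\infty f(u-)\,d\xi_u$ is the limit in probability of $\int_a^T f(u-)\,d\xi_u$ as $T\to\infty$. Suppose that $\int_0^\infty f(u-)\,d\xi_u$ exists and is integrable. Then all the integrals and brackets below exist, and $$M_{s,t}=\int_0^s f(u-)\,d\xi_u+\int_t^\infty f(u-)\,d\xi_u+\frac{\xi_t-\xi_s}{t-s}\int_s^t f(u)\,du+[\xi,f]_s-[\xi,f]_t,\qquad 0\le s<t<\infty,$$ defines a past-future martingale with respect to $(\overline{\mathcal H}_{s,t})$. Moreover, for all $0\le s<t$, almost surely $$M_{s,t}=\mathbb E\Big[\int_0^\infty f(u-)\,d\xi_u\;\Big|\;\mathcal H_{s,t}\Big].$$ -/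

import Mathlib

open MeasureTheory ProbabilityTheory Filter Topology Set
open scoped NNReal ENNReal

/-- A real function on `[0, ∞)` is càdlàg: right-continuous with (finite) left limits. -/
def IsCadlag (x : ℝ≥0 → ℝ) : Prop :=
  ∀ t, ContinuousWithinAt x (Ici t) t ∧ ∃ l : ℝ, Tendsto x (𝓝[<] t) (𝓝 l)

/-- A real-valued Lévy process: it starts at zero, has independent and stationary increments, and
almost all of its paths are càdlàg. -/
structure IsLevyProcess {Ω : Type*} {mΩ : MeasurableSpace Ω} (ξ : ℝ≥0 → Ω → ℝ)
    (P : Measure Ω) : Prop where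
  measurable : ∀ t, Measurable (ξ t)
  zero : ∀ᵐ ω ∂P, ξ 0 ω = 0
  indep : HasIndepIncrements ξ P
  stationary : ∀ s h, IdentDistrib (fun ω ↦ ξ (s + h) ω - ξ s ω) (ξ h) P P
  cadlag : ∀ᵐ ω ∂P, IsCadlag fun t ↦ ξ t ω

/-! ### Limits in probability -/

/-- The family `F` converges in probability along the filter `l` to some random variable. -/
def ConvergesInProb {Ω ι : Type*} {mΩ : MeasurableSpace Ω} (F : ι → Ω → ℝ) (l : Filter ι)
    (P : Measure Ω) : Prop :=
  ∃ I : Ω → ℝ, Measurable I ∧ TendstoInMeasure P F l I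

open Classical in
/-- A measurable version of the limit in probability of `F` along `l` (zero if there is none). -/
noncomputable def limInProb {Ω ι : Type*} {mΩ : MeasurableSpace Ω} (F : ι → Ω → ℝ) (l : Filter ι)
    (P : Measure Ω) : Ω → ℝ :=
  if h : ConvergesInProb F l P then h.choose else 0

/-! ### Stochastic integrals and brackets -/

/-- A finite partition `a = pt 0 ≤ pt 1 ≤ ⋯ ≤ pt N = b` of the interval `[a, b]`. -/
structure TimePartition (a b : ℝ≥0) where
  N : ℕ
  pt : ℕ → ℝ≥0
  mono : Monotone pt
  pt_zero : pt 0 = a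
  pt_last : pt N = b

/-- The mesh of a partition: the length of its longest interval. -/
noncomputable def TimePartition.mesh {a b : ℝ≥0} (π : TimePartition a b) : ℝ≥0 :=
  (Finset.range π.N).sup fun i ↦ π.pt (i + 1) - π.pt i

/-- The filter on the partitions of `[a, b]` that describes `mesh → 0`. -/
noncomputable def meshFilter (a b : ℝ≥0) : Filter (TimePartition a b) :=
  comap TimePartition.mesh (𝓝 0)

/-- The elementary stochastic integral `∑ g(u_i) (ξ_{u_{i+1}} - ξ_{u_i})` over a partition. -/
noncomputable def elementaryIntegral {Ω : Type*} (g : ℝ≥0 → ℝ) (ξ : ℝ≥0 → Ω → ℝ) {a b : ℝ≥0}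
    (π : TimePartition a b) (ω : Ω) : ℝ :=
  ∑ i ∈ Finset.range π.N, g (π.pt i) * (ξ (π.pt (i + 1)) ω - ξ (π.pt i) ω)

/-- The stochastic integral `∫_a^b g(u) dξ_u` over `(a, b]` of a left-continuous deterministic
integrand `g` exists: the elementary integrals converge in probability as the mesh goes to zero. -/
def HasStochIntegral {Ω : Type*} {mΩ : MeasurableSpace Ω} (g : ℝ≥0 → ℝ) (ξ : ℝ≥0 → Ω → ℝ)
    (P : Measure Ω) (a b : ℝ≥0) : Prop :=
  ConvergesInProb (fun π : TimePartition a b ↦ elementaryIntegral g ξ π) (meshFilter a b) P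

/-- The stochastic integral `∫_a^b g(u) dξ_u` over `(a, b]` of a left-continuous deterministic
integrand `g`, for `a ≤ b`. -/
noncomputable def stochIntegral {Ω : Type*} {mΩ : MeasurableSpace Ω} (g : ℝ≥0 → ℝ)
    (ξ : ℝ≥0 → Ω → ℝ) (P : Measure Ω) (a b : ℝ≥0) : Ω → ℝ :=
  limInProb (fun π : TimePartition a b ↦ elementaryIntegral g ξ π) (meshFilter a b) P

/-- The improper integral `∫_a^∞ g(u) dξ_u` exists: `∫_a^T g(u) dξ_u` converges in probability as
`T → ∞`. -/
def HasStochIntegralInfty {Ω : Type*} {mΩ : MeasurableSpace Ω} (g : ℝ≥0 → ℝ) (ξ : ℝ≥0 → Ω → ℝ)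
    (P : Measure Ω) (a : ℝ≥0) : Prop :=
  ConvergesInProb (fun T ↦ stochIntegral g ξ P a T) atTop P

/-- The improper integral `∫_a^∞ g(u) dξ_u`. -/
noncomputable def stochIntegralInfty {Ω : Type*} {mΩ : MeasurableSpace Ω} (g : ℝ≥0 → ℝ)
    (ξ : ℝ≥0 → Ω → ℝ) (P : Measure Ω) (a : ℝ≥0) : Ω → ℝ :=
  limInProb (fun T ↦ stochIntegral g ξ P a T) atTop P

/-- The sum of the products of the increments of `X` and `Y` over a partition. -/
noncomputable def incrementProductSum {Ω : Type*} (X Y : ℝ≥0 → Ω → ℝ) {a b : ℝ≥0}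
    (π : TimePartition a b) (ω : Ω) : ℝ :=
  ∑ i ∈ Finset.range π.N,
    (X (π.pt (i + 1)) ω - X (π.pt i) ω) * (Y (π.pt (i + 1)) ω - Y (π.pt i) ω)

/-- The bracket `[X, Y]_t` exists. -/
def HasBracket {Ω : Type*} {mΩ : MeasurableSpace Ω} (X Y : ℝ≥0 → Ω → ℝ) (P : Measure Ω)
    (t : ℝ≥0) : Prop :=
  ConvergesInProb (fun π : TimePartition 0 t ↦ incrementProductSum X Y π) (meshFilter 0 t) P

/-- The bracket (quadratic covariation) `[X, Y]_t`: the limit in probability of the sums of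
products of increments over partitions of `[0, t]`, as the mesh goes to zero. -/
noncomputable def bracket {Ω : Type*} {mΩ : MeasurableSpace Ω} (X Y : ℝ≥0 → Ω → ℝ) (P : Measure Ω)
    (t : ℝ≥0) : Ω → ℝ :=
  limInProb (fun π : TimePartition 0 t ↦ incrementProductSum X Y π) (meshFilter 0 t) P

/-! ### Past-future filtrations and martingales -/

/-- A past-future filtration: a family of sub-σ-algebras `F_{s,t}` (the information before `s` and
after `t`) that increases when the interval `(s, t)` shrinks. -/
structure PastFutureFiltration {Ω : Type*} (mΩ : MeasurableSpace Ω) where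
  sigma : ℝ≥0 → ℝ≥0 → MeasurableSpace Ω
  le : ∀ s t, sigma s t ≤ mΩ
  anti : ∀ {r s t u : ℝ≥0}, r ≤ s → t ≤ u → sigma r u ≤ sigma s t

/-- A past-future martingale `(M_{s,t})`, `0 ≤ s < t < ∞`, with respect to a past-future
filtration. -/
structure IsPastFutureMartingale {Ω : Type*} {mΩ : MeasurableSpace Ω} (M : ℝ≥0 → ℝ≥0 → Ω → ℝ)
    (F : PastFutureFiltration mΩ) (P : Measure Ω) : Prop where
  integrable : ∀ s t, s < t → Integrable (M s t) P
  measurable : ∀ s t, s < t → Measurable[F.sigma s t] (M s t)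
  condExp_eq : ∀ r s t u, r < s → s < t → t < u → P[M s t|F.sigma r u] =ᵐ[P] M r u

/-- The σ-algebra `H_{s,t} = σ(ξ_u; u ≤ s or u ≥ t)`. -/
abbrev pastFutureSigma {Ω : Type*} (ξ : ℝ≥0 → Ω → ℝ) (s t : ℝ≥0) : MeasurableSpace Ω :=
  ⨆ u ∈ {u : ℝ≥0 | u ≤ s ∨ t ≤ u}, MeasurableSpace.comap (ξ u) inferInstance

/-- The natural past-future filtration of a process, augmented by the null events. -/
def naturalPastFuture {Ω : Type*} {mΩ : MeasurableSpace Ω} (ξ : ℝ≥0 → Ω → ℝ)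
    (hξ : ∀ t, Measurable (ξ t)) (P : Measure Ω) : PastFutureFiltration mΩ where
  sigma s t := pastFutureSigma ξ s t ⊔
    MeasurableSpace.generateFrom {A | MeasurableSet A ∧ P A = 0}
  le _ _ := sup_le (iSup₂_le fun u _ ↦ (hξ u).comap_le)
    (MeasurableSpace.generateFrom_le fun _ hA ↦ hA.1)
  anti hrs htu := sup_le_sup_right
    (biSup_mono fun _ hv ↦ hv.imp (fun h ↦ h.trans hrs) (fun h ↦ htu.trans h)) _

/-- The process
`M_{s,t} = ∫_0^s f(u-) dξ_u + ∫_t^∞ f(u-) dξ_u + (ξ_t - ξ_s)/(t - s) ∫_s^t f(u) du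
  + [ξ, f]_s - [ξ, f]_t`. -/
noncomputable def pastFutureProcess {Ω : Type*} {mΩ : MeasurableSpace Ω} (f : ℝ≥0 → ℝ)
    (ξ : ℝ≥0 → Ω → ℝ) (P : Measure Ω) (s t : ℝ≥0) (ω : Ω) : ℝ :=
  stochIntegral (Function.leftLim f) ξ P 0 s ω + stochIntegralInfty (Function.leftLim f) ξ P t ω
    + (ξ t ω - ξ s ω) / ((t : ℝ) - (s : ℝ)) * (∫ u in (s : ℝ)..t, f u.toNNReal)
    + bracket ξ (fun u _ ↦ f u) P s ω - bracket ξ (fun u _ ↦ f u) P t ω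

/-! The process is a closed martingale: `M s t` is the conditional expectation of I = ∫_0^∞ f(u-)
dξ_u given the past before s and the future after t, so the martingale identity is the tower
property (`pastFutureProcess_ae_eq_condExp`). Splitting I at s and t leaves two pieces that are
already measurable and a middle piece over (s, t] that has to be projected.

For a single increment with s ≤ u ≤ v ≤ t, independence reduces the conditioning to D = ξ_t - ξ_s.
Stationarity makes E[ξ_v - ξ_u; D ∈ B] a function of v - u alone (s, t and B being fixed); it is
additive and continuous, hence linear. So the projection of ξ_v - ξ_u is (v - u)/(t - s) · D
(`condExp_sub_ae_eq`).

The passage to integrals takes place in L¹. The path u ↦ ξ_u is uniformly continuous into L¹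
(`uniformContinuous_pathL1`) and f is a difference of two Stieltjes functions, so summation by parts
makes the elementary sums converge in L¹. Conditional expectation is continuous on L¹ and turns
these sums into Riemann sums of f times D/(t - s) (`condExp_stochIntegral`). The same uniform
continuity sends the sums that define [ξ, f] to 0 in L¹, so the bracket terms vanish almost surely
(`bracket_ae_eq_zero`). -/

/-! ### Partitions -/

namespace TimePartition

variable {a b : ℝ≥0}

lemma sub_le_mesh (π : TimePartition a b) {i : ℕ} (hi : i < π.N) :
    π.pt (i + 1) - π.pt i ≤ π.mesh :=
  Finset.le_sup (f := fun i ↦ π.pt (i + 1) - π.pt i) (Finset.mem_range.2 hi)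

lemma le_pt (π : TimePartition a b) (i : ℕ) : a ≤ π.pt i :=
  π.pt_zero.symm.le.trans (π.mono i.zero_le)

lemma pt_le (π : TimePartition a b) {i : ℕ} (hi : i ≤ π.N) : π.pt i ≤ b :=
  (π.mono hi).trans π.pt_last.le

/-- The partition of `[a, b]` into `n + 1` intervals of equal length. -/
noncomputable def uniform (hab : a ≤ b) (n : ℕ) : TimePartition a b where
  N := n + 1
  pt i := min b (a + i * ((b - a) / (n + 1)))
  mono i j hij := by dsimp only; gcongr
  pt_zero := by simpa using hab
  pt_last := by
    have : (((n + 1 : ℕ) : ℝ≥0)) * ((b - a) / (n + 1)) = b - a := by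
      push_cast; field_simp
    rw [this, add_tsub_cancel_of_le hab, min_self]

lemma mesh_uniform_le (hab : a ≤ b) (n : ℕ) : (uniform hab n).mesh ≤ (b - a) / (n + 1) := by
  refine Finset.sup_le fun i _ ↦ ?_
  simp only [uniform]
  rw [tsub_le_iff_right, Nat.cast_add, Nat.cast_one, add_mul, one_mul, ← add_assoc,
    min_def b (a + i * _)]
  split_ifs with h
  · exact (min_le_left _ _).trans le_add_self
  · rw [add_comm]; exact min_le_right _ _

end TimePartition

/-- Uniform partitions have arbitrarily small mesh. Together with countable generation this makes
limits in probability along the mesh filter almost surely unique. -/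
lemma meshFilter_neBot {a b : ℝ≥0} (hab : a ≤ b) : (meshFilter a b).NeBot := by
  have h : Tendsto (fun n ↦ (TimePartition.uniform hab n).mesh) atTop (𝓝 0) := by
    refine tendsto_of_tendsto_of_tendsto_of_le_of_le tendsto_const_nhds ?_ (fun _ ↦ zero_le)
      (TimePartition.mesh_uniform_le hab)
    have := (tendsto_one_div_add_atTop_nhds_zero_nat (𝕜 := ℝ≥0)).const_mul (b - a)
    simpa [div_eq_mul_inv] using this
  rw [meshFilter, comap_neBot_iff]
  intro s hs
  obtain ⟨n, hn⟩ := (h.eventually hs).exists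
  exact ⟨_, hn⟩

instance meshFilter_isCountablyGenerated (a b : ℝ≥0) : (meshFilter a b).IsCountablyGenerated := by
  unfold meshFilter; infer_instance

lemma tendsto_meshFilter_of_forall {E : Type*} [PseudoMetricSpace E] {a b : ℝ≥0}
    {F : TimePartition a b → E} {L : E} (C : ℝ)
    (h : ∀ ε > 0, ∃ δ > 0, ∀ π, π.mesh < δ → dist (F π) L ≤ ε * C) :
    Tendsto F (meshFilter a b) (𝓝 L) := by
  rw [Metric.tendsto_nhds]
  intro ε hε
  obtain ⟨δ, hδ, H⟩ := h (ε / (|C| + 1)) (by positivity)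
  have : ∀ᶠ π : TimePartition a b in meshFilter a b, π.mesh < δ :=
    tendsto_comap.eventually (gt_mem_nhds hδ)
  filter_upwards [this] with π hπ
  refine (H π hπ).trans_lt ?_
  rw [div_mul_eq_mul_div, div_lt_iff₀ (by positivity)]
  nlinarith [le_abs_self C]

/-! ### Riemann–Stieltjes sums -/

/-- Abel summation: left-endpoint sums against dx become right-endpoint sums against dg. -/
lemma sum_range_smul_sub {E : Type*} [AddCommGroup E] [Module ℝ E] (g : ℕ → ℝ) (x : ℕ → E)
    (n : ℕ) :
    ∑ i ∈ Finset.range n, g i • (x (i + 1) - x i)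
      = g n • x n - g 0 • x 0 - ∑ i ∈ Finset.range n, (g (i + 1) - g i) • x (i + 1) := by
  induction n with
  | zero => simp
  | succ n ih => rw [Finset.sum_range_succ, Finset.sum_range_succ, ih]; module

section Stieltjes

variable {E : Type*} [NormedAddCommGroup E] {X : ℝ≥0 → E} {a b : ℝ≥0}

lemma exists_norm_sub_le_of_mesh_lt (hX : UniformContinuous X) {ε : ℝ} (hε : 0 < ε) :
    ∃ δ > 0, ∀ π : TimePartition a b, π.mesh < δ → ∀ i < π.N,
      ∀ u ∈ Icc (π.pt i) (π.pt (i + 1)), ‖X (π.pt (i + 1)) - X u‖ ≤ ε := by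
  obtain ⟨δ, hδ, H⟩ := Metric.uniformContinuous_iff.1 hX ε hε
  refine ⟨⟨δ, hδ.le⟩, hδ, fun π hπ i hi u hu ↦ ?_⟩
  rw [← dist_eq_norm]
  refine (H ?_).le
  have h1 := (π.sub_le_mesh hi).trans_lt hπ
  have h2 : π.pt (i + 1) - u < ⟨δ, hδ.le⟩ := (tsub_le_tsub_left hu.1 _).trans_lt h1
  rw [NNReal.dist_eq, abs_of_nonneg (sub_nonneg.2 (NNReal.coe_le_coe.2 hu.2)),
    ← NNReal.coe_sub hu.2]
  exact h2

lemma integrableOn_Ico_of_continuous (hX : Continuous X) (p : StieltjesFunction ℝ≥0)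
    (a b : ℝ≥0) : IntegrableOn X (Ico a b) p.measure :=
  (hX.continuousOn.integrableOn_compact isCompact_Icc).mono_set Ico_subset_Icc_self

variable [NormedSpace ℝ E]

lemma setIntegral_Ico_add (hX : Continuous X) (p : StieltjesFunction ℝ≥0) {a b c : ℝ≥0}
    (hab : a ≤ b) (hbc : b ≤ c) :
    ∫ u in Ico a c, X u ∂p.measure
      = ∫ u in Ico a b, X u ∂p.measure + ∫ u in Ico b c, X u ∂p.measure := by
  rw [← Ico_union_Ico_eq_Ico hab hbc, setIntegral_union (by simp) measurableSet_Ico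
    (integrableOn_Ico_of_continuous hX p _ _) (integrableOn_Ico_of_continuous hX p _ _)]

lemma setIntegral_Ico_eq_sum (hX : Continuous X) (p : StieltjesFunction ℝ≥0) {t : ℕ → ℝ≥0}
    (ht : Monotone t) (n : ℕ) :
    ∫ u in Ico (t 0) (t n), X u ∂p.measure
      = ∑ i ∈ Finset.range n, ∫ u in Ico (t i) (t (i + 1)), X u ∂p.measure := by
  induction n with
  | zero => simp
  | succ n ih =>
    rw [Finset.sum_range_succ, ← ih, setIntegral_Ico_add hX p (ht n.zero_le) (ht n.le_succ)]

/-- Increments of the left limit are the masses of the cells [u_i, u_{i+1}). The error on each cell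
is at most its mass times the oscillation of X there, and the masses telescope. -/
lemma tendsto_sum_leftLim_smul [CompleteSpace E] (hX : UniformContinuous X)
    (p : StieltjesFunction ℝ≥0) (a b : ℝ≥0) :
    Tendsto (fun π : TimePartition a b ↦ ∑ i ∈ Finset.range π.N,
        (Function.leftLim p (π.pt (i + 1)) - Function.leftLim p (π.pt i)) • X (π.pt (i + 1)))
      (meshFilter a b) (𝓝 (∫ u in Ico a b, X u ∂p.measure)) := by
  refine tendsto_meshFilter_of_forall (Function.leftLim p b - Function.leftLim p a)
    fun ε hε ↦ ?_
  obtain ⟨δ, hδ, H⟩ := exists_norm_sub_le_of_mesh_lt (a := a) (b := b) hX hε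
  refine ⟨δ, hδ, fun π hπ ↦ ?_⟩
  have hI := setIntegral_Ico_eq_sum hX.continuous p π.mono π.N
  rw [π.pt_zero, π.pt_last] at hI
  rw [hI, dist_eq_norm, ← Finset.sum_sub_distrib]
  have hmono := p.mono.leftLim
  calc _ ≤ ∑ i ∈ Finset.range π.N,
        ε * (Function.leftLim p (π.pt (i + 1)) - Function.leftLim p (π.pt i)) := by
        refine norm_sum_le_of_le _ fun i hi ↦ ?_
        have hnn := sub_nonneg.2 (hmono (π.mono i.le_succ))
        have hvol : p.measure.real (Ico (π.pt i) (π.pt (i + 1)))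
            = Function.leftLim p (π.pt (i + 1)) - Function.leftLim p (π.pt i) := by
          rw [measureReal_def, p.measure_Ico, ENNReal.toReal_ofReal hnn]
        have hfin : p.measure (Ico (π.pt i) (π.pt (i + 1))) < ∞ := by
          rw [p.measure_Ico]; exact ENNReal.ofReal_lt_top
        -- The summand is the integral over the cell of the constant X(u_{i+1}), so the difference
        -- is one integral of a uniformly small function.
        rw [← hvol, ← setIntegral_const, ← integral_sub
          (integrableOn_const hfin.ne).integrable
            (integrableOn_Ico_of_continuous hX.continuous p _ _)]
        exact norm_setIntegral_le_of_norm_le_const hfin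
          fun u hu ↦ H π hπ i (Finset.mem_range.1 hi) u (Ico_subset_Icc_self hu)
    _ = ε * (Function.leftLim p b - Function.leftLim p a) := by
        rw [← Finset.mul_sum, Finset.sum_range_sub (fun i ↦ Function.leftLim p (π.pt i)),
          π.pt_zero, π.pt_last]

/-- The Riemann–Stieltjes integral `∫_a^b (p - q)(u-) dX_u` of the left limit of a difference of
Stieltjes functions against a continuous Banach space valued path, defined by parts. -/
noncomputable def stieltjesIntegral (p q : StieltjesFunction ℝ≥0) (X : ℝ≥0 → E) (a b : ℝ≥0) : E :=
  (Function.leftLim p b - Function.leftLim q b) • X b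
    - (Function.leftLim p a - Function.leftLim q a) • X a
    - (∫ u in Ico a b, X u ∂p.measure - ∫ u in Ico a b, X u ∂q.measure)

lemma stieltjesIntegral_add (hX : Continuous X) (p q : StieltjesFunction ℝ≥0) {a b c : ℝ≥0}
    (hab : a ≤ b) (hbc : b ≤ c) :
    stieltjesIntegral p q X a b + stieltjesIntegral p q X b c = stieltjesIntegral p q X a c := by
  simp only [stieltjesIntegral]
  rw [setIntegral_Ico_add hX p hab hbc, setIntegral_Ico_add hX q hab hbc]
  abel

lemma tendsto_sum_stieltjesIntegral [CompleteSpace E] (hX : UniformContinuous X)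
    (p q : StieltjesFunction ℝ≥0) (a b : ℝ≥0) :
    Tendsto (fun π : TimePartition a b ↦ ∑ i ∈ Finset.range π.N,
        (Function.leftLim p (π.pt i) - Function.leftLim q (π.pt i))
          • (X (π.pt (i + 1)) - X (π.pt i)))
      (meshFilter a b) (𝓝 (stieltjesIntegral p q X a b)) := by
  have key := ((tendsto_sum_leftLim_smul hX p a b).sub
    (tendsto_sum_leftLim_smul hX q a b)).const_sub
    ((Function.leftLim p b - Function.leftLim q b) • X b
    - (Function.leftLim p a - Function.leftLim q a) • X a)
  refine key.congr fun π ↦ ?_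
  rw [sum_range_smul_sub (fun i ↦ Function.leftLim p (π.pt i) - Function.leftLim q (π.pt i))
    (fun i ↦ X (π.pt i)), π.pt_zero, π.pt_last, ← Finset.sum_sub_distrib]
  congr 1
  refine Finset.sum_congr rfl fun i _ ↦ ?_
  module

/-- Each term is at most ε times an increment of p + q, and these increments telescope; no jump of p
- q survives because X is continuous. -/
lemma tendsto_sum_smul_sub_zero (hX : UniformContinuous X) {p q : ℝ≥0 → ℝ} (hp : Monotone p)
    (hq : Monotone q) (a b : ℝ≥0) :
    Tendsto (fun π : TimePartition a b ↦ ∑ i ∈ Finset.range π.N,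
        ((p - q) (π.pt (i + 1)) - (p - q) (π.pt i)) • (X (π.pt (i + 1)) - X (π.pt i)))
      (meshFilter a b) (𝓝 0) := by
  refine tendsto_meshFilter_of_forall (p b - p a + (q b - q a)) fun ε hε ↦ ?_
  obtain ⟨δ, hδ, H⟩ := exists_norm_sub_le_of_mesh_lt (a := a) (b := b) hX hε
  refine ⟨δ, hδ, fun π hπ ↦ ?_⟩
  rw [dist_zero_right]
  calc _ ≤ ∑ i ∈ Finset.range π.N,
        ε * (p (π.pt (i + 1)) - p (π.pt i) + (q (π.pt (i + 1)) - q (π.pt i))) := by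
        refine norm_sum_le_of_le _ fun i hi ↦ ?_
        have h1 := hp (π.mono i.le_succ)
        have h2 := hq (π.mono i.le_succ)
        rw [norm_smul, mul_comm]
        refine mul_le_mul (H π hπ i (Finset.mem_range.1 hi) _
          (left_mem_Icc.2 (π.mono i.le_succ))) ?_ (norm_nonneg _) hε.le
        rw [Real.norm_eq_abs, abs_le, Pi.sub_apply, Pi.sub_apply]
        constructor <;> linarith
    _ = _ := by
        rw [← Finset.mul_sum, Finset.sum_add_distrib, Finset.sum_range_sub (fun i ↦ p (π.pt i)),
          Finset.sum_range_sub (fun i ↦ q (π.pt i)), π.pt_zero, π.pt_last]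

end Stieltjes

/-! ### Riemann sums -/

lemma Monotone.comp_toNNReal {p : ℝ≥0 → ℝ} (hp : Monotone p) :
    Monotone fun u : ℝ ↦ p u.toNNReal :=
  hp.comp fun _ _ h ↦ Real.toNNReal_mono h

/-- The upper bound p u ≤ p(b-) needs u < b, so the comparison is made on the open interval. On a
partition the two bounds differ by at most the mesh times an increment of p(·-), which gives
convergence of the left-limit Riemann sums. -/
lemma Monotone.intervalIntegral_toNNReal_mem_Icc {p : ℝ≥0 → ℝ} (hp : Monotone p) {a b : ℝ≥0}
    (hab : a ≤ b) :
    ∫ u in (a : ℝ)..b, p u.toNNReal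
      ∈ Icc (Function.leftLim p a * ((b : ℝ) - a)) (Function.leftLim p b * ((b : ℝ) - a)) := by
  have hab' : (a : ℝ) ≤ b := hab
  have hint := hp.comp_toNNReal.intervalIntegrable (μ := volume) (a := a) (b := b)
  have hc : ∀ c : ℝ, ∫ _ in (a : ℝ)..b, c = c * ((b : ℝ) - a) := fun c ↦ by
    rw [intervalIntegral.integral_const, smul_eq_mul, mul_comm]
  rw [← hc, ← hc]
  constructor
  · refine intervalIntegral.integral_mono_on_of_le_Ioo hab' (by simp) hint fun u hu ↦ ?_
    exact hp.leftLim_le (NNReal.le_toNNReal_of_coe_le hu.1.le)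
  · refine intervalIntegral.integral_mono_on_of_le_Ioo hab' hint (by simp) fun u hu ↦ ?_
    exact hp.le_leftLim ((Real.toNNReal_lt_iff_lt_coe (a.2.trans hu.1.le)).2 hu.2)

lemma Monotone.tendsto_sum_leftLim_mul_sub {p : ℝ≥0 → ℝ} (hp : Monotone p) (a b : ℝ≥0) :
    Tendsto (fun π : TimePartition a b ↦ ∑ i ∈ Finset.range π.N,
        Function.leftLim p (π.pt i) * ((π.pt (i + 1) : ℝ) - π.pt i))
      (meshFilter a b) (𝓝 (∫ u in (a : ℝ)..b, p u.toNNReal)) := by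
  refine tendsto_meshFilter_of_forall (Function.leftLim p b - Function.leftLim p a)
    fun ε hε ↦ ⟨⟨ε, hε.le⟩, hε, fun π hπ ↦ ?_⟩
  have hI := intervalIntegral.sum_integral_adjacent_intervals (μ := volume)
    (f := fun u : ℝ ↦ p u.toNNReal) (a := fun i ↦ (π.pt i : ℝ)) (n := π.N)
    fun k _ ↦ hp.comp_toNNReal.intervalIntegrable
  rw [π.pt_zero, π.pt_last] at hI
  rw [← hI, dist_eq_norm, ← Finset.sum_sub_distrib]
  calc _ ≤ ∑ i ∈ Finset.range π.N,
        ε * (Function.leftLim p (π.pt (i + 1)) - Function.leftLim p (π.pt i)) := by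
        refine norm_sum_le_of_le _ fun i hi ↦ ?_
        obtain ⟨h1, h2⟩ := hp.intervalIntegral_toNNReal_mem_Icc (π.mono i.le_succ)
        have h3 := hp.leftLim (π.mono i.le_succ)
        have h4 : (π.pt (i + 1) : ℝ) - π.pt i ≤ ε := by
          rw [← NNReal.coe_sub (π.mono i.le_succ)]
          exact (((π.sub_le_mesh (Finset.mem_range.1 hi)).trans_lt hπ).le :)
        rw [Real.norm_eq_abs, abs_le]
        have h5 := mul_le_mul_of_nonneg_right h4 (sub_nonneg.2 h3)
        constructor
        · simp only [Nat.succ_eq_add_one] at *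
          nlinarith
        · have := mul_nonneg hε.le (sub_nonneg.2 h3)
          simp only [Nat.succ_eq_add_one] at *
          linarith
    _ = _ := by
        rw [← Finset.mul_sum, Finset.sum_range_sub (fun i ↦ Function.leftLim p (π.pt i)),
          π.pt_zero, π.pt_last]

/-! ### Decomposition of càdlàg functions of locally finite variation -/

/-- The monotone parts of a Jordan decomposition need not be right-continuous. Replacing both by
their right limits leaves the difference unchanged, since f is right-continuous. -/
lemma IsCadlag.exists_stieltjesFunction_sub {f : ℝ≥0 → ℝ} (hf : IsCadlag f)
    (hf_var : LocallyBoundedVariationOn f univ) :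
    ∃ p q : StieltjesFunction ℝ≥0, f = ⇑p - ⇑q := by
  obtain ⟨p, q, hp, hq, rfl⟩ := hf_var.exists_monotoneOn_sub_monotoneOn
  rw [monotoneOn_univ] at hp hq
  refine ⟨hp.stieltjesFunction, hq.stieltjesFunction, funext fun x ↦ ?_⟩
  change _ = Function.rightLim p x - Function.rightLim q x
  have h1 : Tendsto (p - q) (𝓝[>] x) (𝓝 (Function.rightLim p x - Function.rightLim q x)) :=
    (hp.tendsto_rightLim x).sub (hq.tendsto_rightLim x)
  exact tendsto_nhds_unique ((hf x).1.mono Ioi_subset_Ici_self) h1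

/-- At 0 the left neighbourhood is trivial and `leftLim` returns the value itself, which is the
convention f(0-) = f(0). -/
lemma Monotone.leftLim_sub {p q : ℝ≥0 → ℝ} (hp : Monotone p) (hq : Monotone q) (x : ℝ≥0) :
    Function.leftLim (p - q) x = Function.leftLim p x - Function.leftLim q x := by
  by_cases h : 𝓝[<] x = ⊥
  · simp [leftLim_eq_of_eq_bot _ h]
  · have : (𝓝[<] x).NeBot := ⟨h⟩
    exact leftLim_eq_of_tendsto ((hp.tendsto_leftLim x).sub (hq.tendsto_leftLim x))

/-! ### Continuity of an integrable Lévy process in `L¹` -/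

namespace IsLevyProcess

variable {Ω : Type*} {mΩ : MeasurableSpace Ω} {P : Measure Ω} {ξ : ℝ≥0 → Ω → ℝ}

lemma ae_tendsto_zero (hξ : IsLevyProcess ξ P) :
    ∀ᵐ ω ∂P, Tendsto (fun h ↦ ξ h ω) (𝓝 0) (𝓝 0) := by
  filter_upwards [hξ.zero, hξ.cadlag] with ω h0 hc
  have := (hc 0).1
  rwa [show Ici (0 : ℝ≥0) = univ from Ici_bot, continuousWithinAt_univ, ContinuousAt, h0] at this

lemma identDistrib_sub (hξ : IsLevyProcess ξ P) {u v : ℝ≥0} (huv : u ≤ v) :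
    IdentDistrib (fun ω ↦ ξ v ω - ξ u ω) (ξ (v - u)) P P := by
  simpa [add_tsub_cancel_of_le huv] using hξ.stationary u (v - u)

lemma indepFun_sub (hξ : IsLevyProcess ξ P) {u v : ℝ≥0} (huv : u ≤ v) :
    IndepFun (ξ u) (fun ω ↦ ξ v ω - ξ u ω) P :=
  hξ.indep.indepFun_eval_sub (zero_le (a := u)) huv hξ.zero

lemma integral_abs_sub (hξ : IsLevyProcess ξ P) {u v : ℝ≥0} (huv : u ≤ v) :
    ∫ ω, |ξ v ω - ξ u ω| ∂P = ∫ ω, |ξ (v - u) ω| ∂P :=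
  ((hξ.identDistrib_sub huv).comp continuous_abs.measurable).integral_eq

lemma tendsto_integral_comp [IsProbabilityMeasure P] (hξ : IsLevyProcess ξ P) {G : ℝ × ℝ → ℝ}
    (hG : Continuous G) (C : ℝ) (hC : ∀ x, |G x| ≤ C) (t : ℝ≥0) :
    Tendsto (fun h ↦ ∫ ω, G (ξ h ω, ξ t ω) ∂P) (𝓝 0) (𝓝 (∫ ω, G (0, ξ t ω) ∂P)) := by
  refine tendsto_integral_filter_of_dominated_convergence (fun _ ↦ C) (.of_forall fun h ↦ ?_)
    (.of_forall fun h ↦ .of_forall fun ω ↦ hC _) (integrable_const C) ?_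
  · exact (hG.measurable.comp ((hξ.measurable h).prodMk (hξ.measurable t))).aestronglyMeasurable
  · filter_upwards [hξ.ae_tendsto_zero] with ω hω
    exact (hG.tendsto _).comp (hω.prodMk_nhds tendsto_const_nhds)

/-- If ξ_t - ξ_h is at most K in absolute value, then |ξ_h| > 2K forces |ξ_t| > K. Integrating this
with independence bounds the tail of ξ_h by the tail of ξ_t, uniformly in h once the second factor
is bounded below. -/
lemma integral_max_abs_sub_mul_le [IsProbabilityMeasure P] (hξ : IsLevyProcess ξ P)
    (hξ_int : ∀ t, Integrable (ξ t) P) {K : ℝ} (hK : 0 < K) {h t : ℝ≥0} (ht : h ≤ t) :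
    (∫ ω, max (|ξ h ω| - 2 * K) 0 ∂P) * ∫ ω, max (1 - |ξ t ω - ξ h ω| / K) 0 ∂P
      ≤ ∫ ω, max (|ξ t ω| - K) 0 ∂P := by
  have hm := hξ.measurable
  have hind : IndepFun (fun ω ↦ max (|ξ h ω| - 2 * K) 0)
      (fun ω ↦ max (1 - |ξ t ω - ξ h ω| / K) 0) P :=
    (hξ.indepFun_sub ht).comp (φ := fun x ↦ max (|x| - 2 * K) 0)
      (ψ := fun x ↦ max (1 - |x| / K) 0) (by fun_prop) (by fun_prop)
  rw [← hind.integral_fun_mul_eq_mul_integral (by fun_prop) (by fun_prop)]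
  refine integral_mono_of_nonneg (.of_forall fun ω ↦ by positivity) ?_ (.of_forall fun ω ↦ ?_)
  · exact ((hξ_int t).abs.sub (integrable_const K)).sup (integrable_zero _ _ _)
  · have h1 : |ξ h ω| ≤ |ξ t ω| + |ξ t ω - ξ h ω| := by
      have := abs_sub (ξ t ω) (ξ t ω - ξ h ω)
      rwa [sub_sub_cancel] at this
    dsimp only
    rcases le_total |ξ t ω - ξ h ω| K with hK' | hK'
    · calc max (|ξ h ω| - 2 * K) 0 * max (1 - |ξ t ω - ξ h ω| / K) 0
          ≤ max (|ξ h ω| - 2 * K) 0 * 1 := by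
            refine mul_le_mul_of_nonneg_left (max_le ?_ zero_le_one) (le_max_right _ _)
            have := div_nonneg (abs_nonneg (ξ t ω - ξ h ω)) hK.le
            linarith
        _ ≤ max (|ξ t ω| - K) 0 := by
            rw [mul_one]; exact max_le_max_right _ (by linarith)
    · rw [max_eq_right (b := (0 : ℝ)) (a := 1 - _), mul_zero]
      · exact le_max_right _ _
      · rw [sub_nonpos, le_div_iff₀ hK]; linarith

lemma tendsto_integral_max_abs_sub [IsProbabilityMeasure P] {Y : Ω → ℝ} (hY : Integrable Y P) :
    Tendsto (fun K : ℝ ↦ ∫ ω, max (|Y ω| - K) 0 ∂P) atTop (𝓝 0) := by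
  suffices Tendsto (fun K : ℝ ↦ ∫ ω, max (|Y ω| - K) 0 ∂P) atTop (𝓝 (∫ _ : Ω, (0 : ℝ) ∂P)) by
    simpa using this
  refine tendsto_integral_filter_of_dominated_convergence (fun ω ↦ |Y ω|) (.of_forall fun K ↦ ?_)
    ?_ hY.abs (.of_forall fun ω ↦ ?_)
  · exact ((hY.abs.sub (integrable_const K)).sup (integrable_zero _ _ _)).aestronglyMeasurable
  · filter_upwards [eventually_ge_atTop 0] with K hK
    refine .of_forall fun ω ↦ ?_
    rw [Real.norm_eq_abs, abs_of_nonneg (le_max_right _ _)]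
    exact max_le (by linarith) (abs_nonneg _)
  · refine tendsto_const_nhds.congr' ?_
    filter_upwards [eventually_ge_atTop |Y ω|] with K hK
    rw [max_eq_right (by linarith)]

/-- Since ξ_h → 0 almost surely, only uniform integrability for small h is missing. Write |ξ_h| as
its truncation at 2K plus an excess: bounded convergence handles the former, the tail comparison
with ξ_1 the latter. -/
lemma tendsto_integral_abs [IsProbabilityMeasure P] (hξ : IsLevyProcess ξ P)
    (hξ_int : ∀ t, Integrable (ξ t) P) :
    Tendsto (fun h ↦ ∫ ω, |ξ h ω| ∂P) (𝓝 0) (𝓝 0) := by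
  rw [Metric.tendsto_nhds]
  intro ε hε
  -- K ≥ 4 E|ξ_1| gives E(1 - |ξ_1|/K)⁺ ≥ 3/4, which stays above 1/2 when ξ_1 is replaced by ξ_1 -
  -- ξ_h with h small. The excess is then at most 2 · ε/4, and the truncated part gets the other
  -- ε/2.
  obtain ⟨K, hK1, hK2, hK0⟩ := (((tendsto_integral_max_abs_sub (hξ_int 1)).eventually
    (gt_mem_nhds (show (0 : ℝ) < ε / 4 by positivity))).and
    ((eventually_ge_atTop (4 * ∫ ω, |ξ 1 ω| ∂P)).and (eventually_gt_atTop 0))).exists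
  have hw : 3 / 4 ≤ ∫ ω, max (1 - |ξ 1 ω - 0| / K) 0 ∂P := by
    have h1 : ∫ ω, (1 - |ξ 1 ω| / K) ∂P = 1 - (∫ ω, |ξ 1 ω| ∂P) / K := by
      rw [integral_sub (integrable_const 1) ((hξ_int 1).abs.div_const K), integral_div]
      simp
    have h2 : ∫ ω, (1 - |ξ 1 ω| / K) ∂P ≤ ∫ ω, max (1 - |ξ 1 ω - 0| / K) 0 ∂P := by
      simp_rw [sub_zero]
      have hi := (integrable_const (1 : ℝ)).sub ((hξ_int 1).abs.div_const K)
      exact integral_mono hi (hi.sup (integrable_zero _ _ _)) fun ω ↦ le_max_left _ _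
    have h3 : (∫ ω, |ξ 1 ω| ∂P) / K ≤ 1 / 4 := by
      rw [div_le_iff₀ hK0]; linarith
    linarith
  have hW := (hξ.tendsto_integral_comp (G := fun x ↦ max (1 - |x.2 - x.1| / K) 0) (by fun_prop) 1
    (fun x ↦ by
      rw [abs_of_nonneg (le_max_right _ _)]
      refine max_le ?_ zero_le_one
      have := div_nonneg (abs_nonneg (x.2 - x.1)) hK0.le
      linarith) 1).eventually (lt_mem_nhds (show (1 / 2 : ℝ) < _ by
        refine lt_of_lt_of_le (by norm_num) hw))
  have hmin := hξ.tendsto_integral_comp (G := fun x ↦ min |x.1| (2 * K)) (by fun_prop) (2 * K)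
    (fun x ↦ by
      rw [abs_of_nonneg (by positivity)]
      exact min_le_right _ _) 1
  have hzero : ∫ _ : Ω, min |(0 : ℝ)| (2 * K) ∂P = 0 := by
    simp [hK0.le]
  rw [hzero] at hmin
  have hmin := hmin.eventually (gt_mem_nhds (show (0 : ℝ) < ε / 2 by positivity))
  filter_upwards [hW, hmin, ge_mem_nhds (show (0 : ℝ≥0) < 1 from one_pos)] with h h1 h2 h3
  have h4 := hξ.integral_max_abs_sub_mul_le hξ_int hK0 h3
  have hmax_int : Integrable (fun ω ↦ max (|ξ h ω| - 2 * K) 0) P :=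
    ((hξ_int h).abs.sub (integrable_const _)).sup (integrable_zero _ _ _)
  have hmin_int : Integrable (fun ω ↦ min |ξ h ω| (2 * K)) P :=
    (hξ_int h).abs.inf (integrable_const _)
  have h5 : 0 ≤ ∫ ω, max (|ξ h ω| - 2 * K) 0 ∂P := integral_nonneg fun ω ↦ le_max_right _ _
  have h6 : ∫ ω, |ξ h ω| ∂P
      = ∫ ω, min |ξ h ω| (2 * K) ∂P + ∫ ω, max (|ξ h ω| - 2 * K) 0 ∂P := by
    rw [← integral_add hmin_int hmax_int]
    refine integral_congr_ae (.of_forall fun ω ↦ ?_)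
    dsimp only
    rcases le_total |ξ h ω| (2 * K) with h | h
    · rw [min_eq_left h, max_eq_right (by linarith), add_zero]
    · rw [min_eq_right h, max_eq_left (by linarith)]; ring
  rw [Real.dist_eq, sub_zero, abs_of_nonneg (integral_nonneg fun ω ↦ abs_nonneg _), h6]
  have h7 := mul_le_mul_of_nonneg_left h1.le h5
  linarith

/-- An integrable process as a path in `L¹`. -/
noncomputable def _root_.pathL1 (hξ_int : ∀ t, Integrable (ξ t) P) (u : ℝ≥0) : Ω →₁[P] ℝ :=
  (hξ_int u).toL1 (ξ u)

lemma uniformContinuous_pathL1 [IsProbabilityMeasure P] (hξ : IsLevyProcess ξ P)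
    (hξ_int : ∀ t, Integrable (ξ t) P) :
    UniformContinuous (pathL1 hξ_int) := by
  rw [Metric.uniformContinuous_iff]
  intro ε hε
  obtain ⟨δ, hδ, H⟩ := Metric.eventually_nhds_iff.1
    ((hξ.tendsto_integral_abs hξ_int).eventually (gt_mem_nhds hε))
  refine ⟨δ, hδ, fun {u v} huv ↦ ?_⟩
  wlog h : u ≤ v generalizing u v
  · rw [dist_comm]
    exact this (by rwa [dist_comm]) (le_of_not_ge h)
  have h1 : dist (pathL1 hξ_int u) (pathL1 hξ_int v) = ∫ ω, |ξ v ω - ξ u ω| ∂P := by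
    rw [dist_comm, dist_eq_norm, pathL1, pathL1, ← Integrable.toL1_sub,
      L1.norm_of_fun_eq_integral_norm]
    rfl
  rw [h1, hξ.integral_abs_sub h]
  refine H ?_
  rwa [NNReal.dist_eq, NNReal.coe_sub h, NNReal.coe_zero, sub_zero, abs_sub_comm]

end IsLevyProcess

/-! ### Independence of the σ-algebras generated by increments -/

section Increments

variable {Ω : Type*} {mΩ : MeasurableSpace Ω} {P : Measure Ω} {ξ : ℝ≥0 → Ω → ℝ}

/-- The σ-algebra generated by the increments of `ξ` between times in `S`. -/
@[reducible] def incrementSigma (ξ : ℝ≥0 → Ω → ℝ) (S : Set ℝ≥0) : MeasurableSpace Ω :=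
  ⨆ r ∈ S, ⨆ u ∈ S, MeasurableSpace.comap (fun ω ↦ ξ u ω - ξ r ω) inferInstance

lemma measurable_incrementSigma {S : Set ℝ≥0} {r u : ℝ≥0} (hr : r ∈ S) (hu : u ∈ S) :
    Measurable[incrementSigma ξ S] fun ω ↦ ξ u ω - ξ r ω :=
  (comap_measurable _).mono ((le_biSup (fun u ↦ MeasurableSpace.comap
    (fun ω ↦ ξ u ω - ξ r ω) inferInstance) hu).trans (le_biSup (fun r ↦ ⨆ u ∈ S,
      MeasurableSpace.comap (fun ω ↦ ξ u ω - ξ r ω) inferInstance) hr)) le_rfl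

lemma incrementSigma_le_iff {S : Set ℝ≥0} {m : MeasurableSpace Ω} :
    incrementSigma ξ S ≤ m ↔ ∀ r ∈ S, ∀ u ∈ S, Measurable[m] fun ω ↦ ξ u ω - ξ r ω := by
  simp only [incrementSigma, iSup_le_iff, measurable_iff_comap_le]

lemma incrementSigma_mono {S T : Set ℝ≥0} (h : S ⊆ T) : incrementSigma ξ S ≤ incrementSigma ξ T :=
  incrementSigma_le_iff.2 fun _ hr _ hu ↦ measurable_incrementSigma (h hr) (h hu)

lemma incrementSigma_le (hξ : ∀ t, Measurable (ξ t)) (S : Set ℝ≥0) : incrementSigma ξ S ≤ mΩ :=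
  incrementSigma_le_iff.2 fun r _ u _ ↦ (hξ u).sub (hξ r)

lemma Finset.exists_monotone_subset_range {α : Type*} [LinearOrder α] (S : Finset α)
    (hS : S.Nonempty) : ∃ t : ℕ → α, Monotone t ∧ (S : Set α) ⊆ Set.range t := by
  have hc : 0 < S.card := hS.card_pos
  -- Capping the index repeats the maximum forever, so the finite enumeration extends to a monotone
  -- sequence.
  refine ⟨fun i ↦ S.orderEmbOfFin rfl ⟨min i (S.card - 1), by omega⟩, fun i j hij ↦ ?_, ?_⟩
  · refine (S.orderEmbOfFin rfl).monotone ?_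
    exact min_le_min_right _ hij
  · rw [← S.range_orderEmbOfFin rfl]
    rintro _ ⟨i, rfl⟩
    exact ⟨i, congrArg _ (Fin.ext (min_eq_left (by have := i.2; omega)))⟩

lemma measurable_sub_of_steps {m : MeasurableSpace Ω} {t : ℕ → ℝ≥0} (k n : ℕ)
    (h : ∀ i, k ≤ i → i < k + n → Measurable[m] fun ω ↦ ξ (t (i + 1)) ω - ξ (t i) ω) :
    Measurable[m] fun ω ↦ ξ (t (k + n)) ω - ξ (t k) ω := by
  have : (fun ω ↦ ξ (t (k + n)) ω - ξ (t k) ω)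
      = fun ω ↦ ∑ i ∈ Finset.range n, (ξ (t (k + i + 1)) ω - ξ (t (k + i)) ω) := by
    ext ω
    exact (Finset.sum_range_sub (fun i ↦ ξ (t (k + i)) ω) n).symm
  rw [this]
  refine Finset.measurable_fun_sum _ fun i hi ↦ h _ (by omega) ?_
  have := Finset.mem_range.1 hi
  omega

/-- All times lie on one monotone sequence through a. Increments before a are sums of steps of index
below k, those after a sums of steps of index at least k, and these two families of steps are
independent. -/
lemma ProbabilityTheory.HasIndepIncrements.indep_incrementSigma_finset
    (hξ : HasIndepIncrements ξ P) (hm : ∀ t, Measurable (ξ t)) (a : ℝ≥0) (J K : Finset ℝ≥0) :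
    Indep (incrementSigma ξ (J ∩ Iic a)) (incrementSigma ξ (K ∩ Ici a)) P := by
  obtain ⟨t, ht, hrange⟩ := (insert a (J ∪ K)).exists_monotone_subset_range (by simp)
  have hmem : ∀ r ∈ insert a (J ∪ K), ∃ i, t i = r := fun r hr ↦ hrange (Finset.mem_coe.2 hr)
  obtain ⟨k, hk⟩ := hmem a (by simp)
  let m : ℕ → MeasurableSpace Ω := fun i ↦
    MeasurableSpace.comap (fun ω ↦ ξ (t (i + 1)) ω - ξ (t i) ω) inferInstance
  have hle : ∀ i, m i ≤ mΩ := fun i ↦ ((hm _).sub (hm _)).comap_le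
  have hind : iIndep m P := (iIndepFun_iff_iIndep _ _ _).1 (hξ.nat ht)
  have key := indep_iSup_of_disjoint hle hind (S := Iio k) (T := Ici k)
    (Set.disjoint_left.2 fun i hi hi' ↦ absurd (mem_Iio.1 hi) (not_lt.2 hi'))
  have hstep : ∀ (S : Set ℕ) (i : ℕ), i ∈ S →
      Measurable[⨆ i ∈ S, m i] fun ω ↦ ξ (t (i + 1)) ω - ξ (t i) ω := fun S i hi ↦
    (comap_measurable _).mono (le_biSup m hi) le_rfl
  refine indep_of_indep_of_le_left (indep_of_indep_of_le_right key ?_) ?_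
  · have h1 : ∀ r ∈ (K : Set ℝ≥0) ∩ Ici a,
        Measurable[⨆ i ∈ Ici k, m i] fun ω ↦ ξ r ω - ξ (t k) ω := by
      rintro r ⟨hr, har⟩
      obtain ⟨i, rfl⟩ := hmem r (by simp [Finset.mem_coe.1 hr])
      -- The sequence may repeat values, so t i ≥ a does not give i ≥ k; when i < k, monotonicity
      -- forces t i = a = t k.
      have hi : t i = t (k + (max i k - k)) := by
        rw [show k + (max i k - k) = max i k by omega, ht.map_max, hk, max_eq_left har]
      rw [hi]
      exact measurable_sub_of_steps k _ fun i hi _ ↦ hstep _ i hi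
    refine incrementSigma_le_iff.2 fun r hr u hu ↦ ?_
    simpa [Pi.sub_def] using (h1 u hu).sub (h1 r hr)
  · have h1 : ∀ r ∈ (J : Set ℝ≥0) ∩ Iic a,
        Measurable[⨆ i ∈ Iio k, m i] fun ω ↦ ξ r ω - ξ (t 0) ω := by
      rintro r ⟨hr, har⟩
      obtain ⟨i, rfl⟩ := hmem r (by simp [Finset.mem_coe.1 hr])
      have hi : t i = t (0 + min i k) := by
        rw [zero_add, ht.map_min, hk, min_eq_left har]
      rw [hi]
      exact measurable_sub_of_steps 0 _ fun i _ hi ↦ hstep _ i (mem_Iio.2 (by omega))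
    refine incrementSigma_le_iff.2 fun r hr u hu ↦ ?_
    simpa [Pi.sub_def] using (h1 u hu).sub (h1 r hr)

lemma incrementSigma_le_iSup_finset (S : Set ℝ≥0) :
    incrementSigma ξ S ≤ ⨆ J : Finset ℝ≥0, incrementSigma ξ (J ∩ S) := by
  refine incrementSigma_le_iff.2 fun r hr u hu ↦ ?_
  exact (measurable_incrementSigma (S := (({r, u} : Finset ℝ≥0) : Set ℝ≥0) ∩ S) (r := r) (u := u)
    (by simp [hr]) (by simp [hu])).mono
      (le_iSup (fun J : Finset ℝ≥0 ↦ incrementSigma ξ (J ∩ S)) {r, u}) le_rfl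

lemma ProbabilityTheory.HasIndepIncrements.indep_incrementSigma [IsProbabilityMeasure P]
    (hξ : HasIndepIncrements ξ P) (hm : ∀ t, Measurable (ξ t)) (a : ℝ≥0) :
    Indep (incrementSigma ξ (Iic a)) (incrementSigma ξ (Ici a)) P := by
  have hmono : ∀ S : Set ℝ≥0, Monotone fun J : Finset ℝ≥0 ↦ incrementSigma ξ (J ∩ S) :=
    fun S J K h ↦ incrementSigma_mono (inter_subset_inter_left _ (Finset.coe_subset.2 h))
  have hle : ∀ S : Set ℝ≥0, ∀ J : Finset ℝ≥0, incrementSigma ξ (J ∩ S) ≤ mΩ :=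
    fun S J ↦ incrementSigma_le hm _
  refine indep_of_indep_of_le_left (indep_of_indep_of_le_right ?_
    (incrementSigma_le_iSup_finset (Ici a))) (incrementSigma_le_iSup_finset (Iic a))
  refine indep_iSup_of_monotone (fun J ↦ ?_) (hle _) (iSup_le (hle _)) (hmono _)
  refine (indep_iSup_of_monotone (fun K ↦ ?_) (hle _) (hle _ _) (hmono _)).symm
  exact (hξ.indep_incrementSigma_finset hm a J K).symm

end Increments

lemma ProbabilityTheory.Indep.setIntegral_eq_measureReal_mul {Ω : Type*}
    {m₁ m₂ mΩ : MeasurableSpace Ω} {P : Measure Ω} [IsProbabilityMeasure P]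
    (h : Indep m₁ m₂ P) (hm₁ : m₁ ≤ mΩ) (hm₂ : m₂ ≤ mΩ)
    {Y : Ω → ℝ} (hY : Measurable[m₁] Y) (hY_int : Integrable Y P) {C : Set Ω}
    (hC : MeasurableSet[m₂] C) : ∫ ω in C, Y ω ∂P = P.real C * ∫ ω, Y ω ∂P := by
  rw [← setIntegral_condExp hm₂ hY_int hC]
  have := condExp_indep_eq hm₁ hm₂ hY.stronglyMeasurable h
  rw [setIntegral_congr_ae (g := fun _ ↦ ∫ ω, Y ω ∂P) (hm₂ _ hC) (this.mono fun _ h _ ↦ h),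
    setIntegral_const, smul_eq_mul]

/-- Independence is used twice: at t to split off C from Y 1_A, then at s to split off A from Y. -/
lemma ProbabilityTheory.HasIndepIncrements.setIntegral_inter {Ω : Type*} {mΩ : MeasurableSpace Ω}
    {P : Measure Ω} [IsProbabilityMeasure P] {ξ : ℝ≥0 → Ω → ℝ} (hξ : HasIndepIncrements ξ P)
    (hm : ∀ t, Measurable (ξ t)) {s t : ℝ≥0} (hst : s ≤ t) {Y : Ω → ℝ}
    (hY : Measurable[incrementSigma ξ (Icc s t)] Y) (hY_int : Integrable Y P) {A C : Set Ω}
    (hA : MeasurableSet[incrementSigma ξ (Iic s)] A)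
    (hC : MeasurableSet[incrementSigma ξ (Ici t)] C) :
    ∫ ω in A ∩ C, Y ω ∂P = P.real A * P.real C * ∫ ω, Y ω ∂P := by
  have hle := incrementSigma_le (mΩ := mΩ) hm
  have hA' := hle _ _ hA
  have h1 : ∫ ω in C, A.indicator Y ω ∂P = P.real C * ∫ ω, A.indicator Y ω ∂P := by
    refine (hξ.indep_incrementSigma hm t).setIntegral_eq_measureReal_mul (hle _) (hle _) ?_
      (hY_int.indicator hA') hC
    exact (hY.mono (incrementSigma_mono Icc_subset_Iic_self) le_rfl).indicator
      (incrementSigma_mono (Iic_subset_Iic.2 hst) _ hA)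
  rw [setIntegral_indicator hA', integral_indicator hA', inter_comm,
    (hξ.indep_incrementSigma hm s).symm.setIntegral_eq_measureReal_mul (hle _) (hle _)
      (hY.mono (incrementSigma_mono Icc_subset_Ici_self) le_rfl) hY_int hA] at h1
  rw [h1]; ring

/-! ### Exchangeability of the increments -/

namespace IsLevyProcess

variable {Ω : Type*} {mΩ : MeasurableSpace Ω} {P : Measure Ω} {ξ : ℝ≥0 → Ω → ℝ}

/-- Exchangeability: the two outer increments together are independent of the middle one and have
the law of a single increment of their total length. The position of [u, v] inside [s, t] therefore
does not affect the joint law. -/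
lemma identDistrib_prodMk_sub [IsProbabilityMeasure P] (hξ : IsLevyProcess ξ P) {s u v t : ℝ≥0}
    (hsu : s ≤ u) (huv : u ≤ v) (hvt : v ≤ t) :
    IdentDistrib (fun ω ↦ (ξ v ω - ξ u ω, ξ t ω - ξ s ω))
      (fun ω ↦ (ξ (v - u) ω, ξ (t - s) ω)) P P := by
  have hm := hξ.measurable
  let τ : ℕ → ℝ≥0
    | 0 => s
    | 1 => u
    | 2 => v
    | _ => t
  have hτ : Monotone τ := by
    refine monotone_nat_of_le_succ fun n ↦ ?_
    match n with
    | 0 => exact hsu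
    | 1 => exact huv
    | 2 => exact hvt
    | n + 3 => exact le_rfl
  have hind := hξ.indep.nat hτ
  have h02 : IndepFun (fun ω ↦ ξ u ω - ξ s ω) (fun ω ↦ ξ t ω - ξ v ω) P :=
    hind.indepFun (i := 0) (j := 2) (by norm_num)
  have h1 : IndepFun (fun ω ↦ ξ v ω - ξ u ω)
      ((fun ω ↦ ξ u ω - ξ s ω) + fun ω ↦ ξ t ω - ξ v ω) P :=
    hind.indepFun_add_right (fun i ↦ (hm _).sub (hm _)) 1 0 2 (by norm_num) (by norm_num)
  have hsum : (u - s) + (t - v) = (t - s) - (v - u) := by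
    apply NNReal.coe_injective
    have h4 : v - u ≤ t - s := tsub_le_tsub hvt hsu
    rw [NNReal.coe_add, NNReal.coe_sub h4, NNReal.coe_sub hsu, NNReal.coe_sub hvt,
      NNReal.coe_sub (hsu.trans (huv.trans hvt)), NNReal.coe_sub huv]
    ring
  have hW : IdentDistrib ((fun ω ↦ ξ u ω - ξ s ω) + fun ω ↦ ξ t ω - ξ v ω)
      (ξ ((t - s) - (v - u))) P P := by
    rw [← hsum]
    have := ((hξ.identDistrib_sub hsu).prodMk ((hξ.identDistrib_sub hvt).trans
      (hξ.stationary (u - s) (t - v)).symm) h02 (hξ.indepFun_sub le_self_add)).comp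
      (u := fun x : ℝ × ℝ ↦ x.1 + x.2) (by fun_prop)
    simpa [Function.comp_def, Pi.add_def] using this
  have h4 : v - u ≤ t - s := tsub_le_tsub hvt hsu
  have := ((hξ.identDistrib_sub huv).prodMk (hW.trans (hξ.identDistrib_sub h4).symm)
    h1 (hξ.indepFun_sub h4)).comp (u := fun x : ℝ × ℝ ↦ (x.1, x.1 + x.2)) (by fun_prop)
  convert this using 1
  · ext ω
    · rfl
    · simp only [Function.comp_apply, Pi.add_apply]; ring
  · ext ω
    · rfl
    · simp

end IsLevyProcess

/-- Cauchy's functional equation on [0, L]: additivity gives the rational multiples of L, continuity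
the rest. -/
lemma eq_div_mul_of_continuous_of_add {ψ : ℝ≥0 → ℝ} (hψ : Continuous ψ) {L : ℝ≥0} (hL : 0 < L)
    (hadd : ∀ h k, h + k ≤ L → ψ (h + k) = ψ h + ψ k) {h : ℝ≥0} (hh : h ≤ L) :
    ψ h = h / L * ψ L := by
  have h0 : ψ 0 = 0 := by simpa using hadd 0 0 (by simp)
  have hmul : ∀ n : ℕ, 0 < n → ∀ k ≤ n, ψ ((k : ℝ≥0) / n * L) = k * ψ (L / n) := by
    intro n hn k
    have hn' : (n : ℝ≥0) ≠ 0 := by positivity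
    induction k with
    | zero => simp [h0]
    | succ k ih =>
      intro hk
      have e : ((k + 1 : ℕ) : ℝ≥0) / n * L = (k : ℝ≥0) / n * L + L / n := by
        push_cast; field_simp
      rw [e, hadd, ih (by omega)]
      · push_cast; ring
      · rw [← e]
        refine mul_le_of_le_one_left' ?_
        rw [div_le_one (by positivity)]
        exact_mod_cast hk
  have hdiv : ∀ n : ℕ, 0 < n → ∀ k ≤ n, ψ ((k : ℝ≥0) / n * L) = (k : ℝ) / n * ψ L := by
    intro n hn k hk
    have hn' : (n : ℝ≥0) ≠ 0 := by positivity
    have h1 := hmul n hn n le_rfl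
    rw [div_self hn', one_mul] at h1
    rw [hmul n hn k hk, h1]
    have : (n : ℝ) ≠ 0 := by positivity
    field_simp
  set x : ℝ≥0 := h / L with hx
  have hx1 : x ≤ 1 := by rw [hx, div_le_one hL]; exact hh
  -- The approximants ⌊xn⌋/n lie below x ≤ 1, so the additivity hypothesis is only used inside [0,
  -- L].
  have hlim : Tendsto (fun n : ℕ ↦ (⌊(x : ℝ) * n⌋₊ : ℝ) / n) atTop (𝓝 (x : ℝ)) :=
    (tendsto_nat_floor_mul_div_atTop x.2).comp tendsto_natCast_atTop_atTop
  have hlim' : Tendsto (fun n : ℕ ↦ (⌊(x : ℝ) * n⌋₊ : ℝ≥0) / n) atTop (𝓝 x) := by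
    rw [← NNReal.tendsto_coe]
    simpa using hlim
  have e1 : Tendsto (fun n : ℕ ↦ ψ ((⌊(x : ℝ) * n⌋₊ : ℝ≥0) / n * L)) atTop (𝓝 (ψ (x * L))) :=
    (hψ.tendsto _).comp (hlim'.mul_const L)
  have e2 := tendsto_nhds_unique (e1.congr' ?_) (hlim.mul_const (ψ L))
  · rw [hx, div_mul_cancel₀ _ hL.ne', NNReal.coe_div] at e2
    exact e2
  · filter_upwards [eventually_gt_atTop 0] with n hn
    refine hdiv n hn _ ?_
    have h2 : (x : ℝ) * n ≤ n := mul_le_of_le_one_left n.cast_nonneg hx1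
    exact_mod_cast (Nat.floor_le_floor h2).trans (Nat.floor_natCast n).le

namespace IsLevyProcess

variable {Ω : Type*} {mΩ : MeasurableSpace Ω} {P : Measure Ω} {ξ : ℝ≥0 → Ω → ℝ}

lemma setIntegral_sub_eq [IsProbabilityMeasure P] (hξ : IsLevyProcess ξ P)
    {s u v t : ℝ≥0} (hsu : s ≤ u) (huv : u ≤ v) (hvt : v ≤ t) {B : Set ℝ} (hB : MeasurableSet B) :
    ∫ ω in (fun ω ↦ ξ t ω - ξ s ω) ⁻¹' B, (ξ v ω - ξ u ω) ∂P
      = ∫ ω in ξ (t - s) ⁻¹' B, ξ (v - u) ω ∂P := by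
  have hm := hξ.measurable
  have hD : Measurable fun ω ↦ ξ t ω - ξ s ω := (hm t).sub (hm s)
  have hG : Measurable fun x : ℝ × ℝ ↦ (B.indicator (fun _ ↦ (1 : ℝ)) x.2) * x.1 :=
    ((measurable_const.indicator hB).comp measurable_snd).mul measurable_fst
  have := ((hξ.identDistrib_prodMk_sub hsu huv hvt).comp hG).integral_eq
  rw [← integral_indicator (hD hB), ← integral_indicator (hm _ hB)]
  convert this using 1 <;>
  · refine integral_congr_ae (.of_forall fun ω ↦ ?_)
    simp only [indicator, Function.comp_apply, ite_mul, one_mul, zero_mul]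
    rfl

lemma setIntegral_sub_eq_div_mul [IsProbabilityMeasure P] (hξ : IsLevyProcess ξ P)
    (hξ_int : ∀ t, Integrable (ξ t) P) {s u v t : ℝ≥0} (hst : s < t) (hsu : s ≤ u) (huv : u ≤ v)
    (hvt : v ≤ t) {B : Set ℝ} (hB : MeasurableSet B) :
    ∫ ω in (fun ω ↦ ξ t ω - ξ s ω) ⁻¹' B, (ξ v ω - ξ u ω) ∂P
      = ((v : ℝ) - u) / ((t : ℝ) - s)
        * ∫ ω in (fun ω ↦ ξ t ω - ξ s ω) ⁻¹' B, (ξ t ω - ξ s ω) ∂P := by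
  have hm := hξ.measurable
  set L := t - s with hL
  let ψ : ℝ≥0 → ℝ := fun h ↦ ∫ ω in ξ L ⁻¹' B, ξ h ω ∂P
  have hcont : Continuous ψ := by
    have h1 := (continuous_setIntegral (μ := P) (E := ℝ) (ξ L ⁻¹' B)).comp
      (hξ.uniformContinuous_pathL1 hξ_int).continuous
    refine h1.congr fun h ↦ ?_
    exact setIntegral_congr_ae (hm _ hB) ((hξ_int h).coeFn_toL1.mono fun _ h _ ↦ h)
  have hadd : ∀ h k, h + k ≤ L → ψ (h + k) = ψ h + ψ k := by
    intro h k hhk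
    -- Moving the increment over [h, h + k] to the start of [0, L] gives ψ(h + k) - ψ(h) = ψ(k).
    have h1 := hξ.setIntegral_sub_eq zero_le (le_self_add : h ≤ h + k) hhk hB
    rw [tsub_zero, add_tsub_cancel_left] at h1
    have hset : ((fun ω ↦ ξ L ω - ξ 0 ω) ⁻¹' B : Set Ω) =ᵐ[P] ξ L ⁻¹' B := by
      filter_upwards [hξ.zero] with ω hω
      change ((ξ L ω - ξ 0 ω ∈ B) : Prop) = (ξ L ω ∈ B)
      rw [hω, sub_zero]
    rw [setIntegral_congr_set hset, integral_sub (hξ_int _).integrableOn (hξ_int _).integrableOn]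
      at h1
    change ψ (h + k) - ψ h = ψ k at h1
    linarith
  rw [hξ.setIntegral_sub_eq hsu huv hvt hB, hξ.setIntegral_sub_eq le_rfl hst.le le_rfl hB]
  have := eq_div_mul_of_continuous_of_add hcont (tsub_pos_of_lt hst) hadd
    (tsub_le_tsub hvt hsu : v - u ≤ L)
  rw [NNReal.coe_sub huv, NNReal.coe_sub hst.le] at this
  exact this

end IsLevyProcess

/-! ### Conditional expectations of increments -/

lemma MeasurableSpace.sup_sup_eq_generateFrom_inter {Ω : Type*} (m₁ m₂ m₃ : MeasurableSpace Ω) :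
    m₁ ⊔ m₂ ⊔ m₃ = generateFrom {S | ∃ A B C, MeasurableSet[m₁] A ∧ MeasurableSet[m₂] B ∧
      MeasurableSet[m₃] C ∧ S = A ∩ B ∩ C} := by
  refine le_antisymm (sup_le (sup_le ?_ ?_) ?_) (generateFrom_le ?_)
  · exact fun A hA ↦ measurableSet_generateFrom
      ⟨A, univ, univ, hA, MeasurableSet.univ, MeasurableSet.univ, by simp⟩
  · exact fun A hA ↦ measurableSet_generateFrom
      ⟨univ, A, univ, MeasurableSet.univ, hA, MeasurableSet.univ, by simp⟩
  · exact fun A hA ↦ measurableSet_generateFrom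
      ⟨univ, univ, A, MeasurableSet.univ, MeasurableSet.univ, hA, by simp⟩
  · rintro _ ⟨A, B, C, hA, hB, hC, rfl⟩
    have h₁ : m₁ ≤ m₁ ⊔ m₂ ⊔ m₃ := le_sup_left.trans le_sup_left
    have h₂ : m₂ ≤ m₁ ⊔ m₂ ⊔ m₃ := le_sup_right.trans le_sup_left
    have h₃ : m₃ ≤ m₁ ⊔ m₂ ⊔ m₃ := le_sup_right
    exact ((h₁ _ hA).inter (h₂ _ hB)).inter (h₃ _ hC)

lemma isPiSystem_inter_inter {Ω : Type*} (m₁ m₂ m₃ : MeasurableSpace Ω) :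
    IsPiSystem {S | ∃ A B C, MeasurableSet[m₁] A ∧ MeasurableSet[m₂] B ∧
      MeasurableSet[m₃] C ∧ S = A ∩ B ∩ C} := by
  rintro _ ⟨A, B, C, hA, hB, hC, rfl⟩ _ ⟨A', B', C', hA', hB', hC', rfl⟩ -
  exact ⟨A ∩ A', B ∩ B', C ∩ C', hA.inter hA', hB.inter hB', hC.inter hC', by
    ext; simp only [mem_inter_iff]; tauto⟩

lemma setIntegral_eq_zero_of_generateFrom {Ω : Type*} {m mΩ : MeasurableSpace Ω} {P : Measure Ω}
    (hm : m ≤ mΩ) {C : Set (Set Ω)} (hmC : m = MeasurableSpace.generateFrom C) (hC : IsPiSystem C)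
    (huniv : univ ∈ C) {Z : Ω → ℝ} (hZ : Integrable Z P) (h : ∀ A ∈ C, ∫ ω in A, Z ω ∂P = 0)
    {A : Set Ω} (hA : MeasurableSet[m] A) : ∫ ω in A, Z ω ∂P = 0 := by
  induction A, hA using MeasurableSpace.induction_on_inter hmC hC with
  | empty => simp
  | basic A hA => exact h A hA
  | compl A hA ih =>
    have := integral_add_compl (hm _ hA) hZ
    have h0 := h univ huniv
    rw [setIntegral_univ] at h0
    linarith
  | iUnion f hdisj hf ih =>
    rw [integral_iUnion (fun i ↦ hm _ (hf i)) hdisj hZ.integrableOn]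
    simp [ih]

namespace IsLevyProcess

variable {Ω : Type*} {mΩ : MeasurableSpace Ω} {P : Measure Ω} {ξ : ℝ≥0 → Ω → ℝ}

/-- The σ-algebra generated by the increments of `ξ` before `s`, the increments after `t` and the
increment over `[s, t]`. -/
@[reducible] def _root_.pastFutureIncrementSigma (ξ : ℝ≥0 → Ω → ℝ) (s t : ℝ≥0) :
    MeasurableSpace Ω :=
  incrementSigma ξ (Iic s) ⊔ MeasurableSpace.comap (fun ω ↦ ξ t ω - ξ s ω) inferInstance
    ⊔ incrementSigma ξ (Ici t)

/-- By a π-λ argument it suffices to take A ∩ {D ∈ B} ∩ C with A from the past and C from the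
future. These two factor out, and what remains vanishes by linearity in v - u. -/
lemma setIntegral_pastFutureIncrementSigma_eq_zero [IsProbabilityMeasure P]
    (hξ : IsLevyProcess ξ P) (hξ_int : ∀ t, Integrable (ξ t) P) {s u v t : ℝ≥0} (hst : s < t)
    (hsu : s ≤ u) (huv : u ≤ v) (hvt : v ≤ t) {A : Set Ω}
    (hA : MeasurableSet[pastFutureIncrementSigma ξ s t] A) :
    ∫ ω in A, (ξ v ω - ξ u ω - ((v : ℝ) - u) / ((t : ℝ) - s) * (ξ t ω - ξ s ω)) ∂P = 0 := by
  have hm := hξ.measurable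
  have hD : Measurable fun ω ↦ ξ t ω - ξ s ω := (hm t).sub (hm s)
  have hint : ∀ u v, Integrable (fun ω ↦ ξ v ω - ξ u ω) P := fun u v ↦ (hξ_int v).sub (hξ_int u)
  have hZ := (hint u v).sub ((hint s t).const_mul (((v : ℝ) - u) / ((t : ℝ) - s)))
  have hle : pastFutureIncrementSigma ξ s t ≤ mΩ :=
    sup_le (sup_le (incrementSigma_le hm _) hD.comap_le) (incrementSigma_le hm _)
  refine setIntegral_eq_zero_of_generateFrom hle
    (MeasurableSpace.sup_sup_eq_generateFrom_inter _ _ _) (isPiSystem_inter_inter _ _ _)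
    ⟨univ, univ, univ, MeasurableSet.univ, MeasurableSet.univ, MeasurableSet.univ, by simp⟩ hZ ?_
    hA
  rintro _ ⟨A, B', C, hA, ⟨B, hB, rfl⟩, hC, rfl⟩
  have hDI : Measurable[incrementSigma ξ (Icc s t)] fun ω ↦ ξ t ω - ξ s ω :=
    measurable_incrementSigma (left_mem_Icc.2 hst.le) (right_mem_Icc.2 hst.le)
  have hXI : Measurable[incrementSigma ξ (Icc s t)] fun ω ↦ ξ v ω - ξ u ω :=
    measurable_incrementSigma ⟨hsu, huv.trans hvt⟩ ⟨hsu.trans huv, hvt⟩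
  have key := hξ.indep.setIntegral_inter hm hst.le
    ((hXI.sub (hDI.const_mul (((v : ℝ) - u) / ((t : ℝ) - s)))).indicator (hDI hB))
    (hZ.indicator (hD hB)) hA hC
  rw [setIntegral_indicator (hD hB), integral_indicator (hD hB)] at key
  rw [inter_right_comm]
  refine key.trans ?_
  have h1 := hξ.setIntegral_sub_eq_div_mul hξ_int hst hsu huv hvt hB
  have h2 := integral_sub (hint u v).integrableOn.integrable
    ((hint s t).const_mul (((v : ℝ) - u) / ((t : ℝ) - s))).integrableOn.integrable
    (μ := P.restrict ((fun ω ↦ ξ t ω - ξ s ω) ⁻¹' B))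
  rw [integral_const_mul, h1, sub_self] at h2
  exact mul_eq_zero_of_right _ h2

/-- Allowing any m that makes D measurable and lies in the completion covers both H_{s,t} and its
augmentation. -/
lemma condExp_sub_ae_eq [IsProbabilityMeasure P]
    (hξ : IsLevyProcess ξ P) (hξ_int : ∀ t, Integrable (ξ t) P) {s u v t : ℝ≥0} (hst : s < t)
    (hsu : s ≤ u) (huv : u ≤ v) (hvt : v ≤ t) {m : MeasurableSpace Ω} (hm : m ≤ mΩ)
    (hmD : Measurable[m] fun ω ↦ ξ t ω - ξ s ω)
    (hle : m ≤ eventuallyMeasurableSpace (pastFutureIncrementSigma ξ s t) (ae P)) :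
    P[fun ω ↦ ξ v ω - ξ u ω|m]
      =ᵐ[P] fun ω ↦ ((v : ℝ) - u) / ((t : ℝ) - s) * (ξ t ω - ξ s ω) := by
  have hint : ∀ u v, Integrable (fun ω ↦ ξ v ω - ξ u ω) P := fun u v ↦ (hξ_int v).sub (hξ_int u)
  have hint' := (hint s t).const_mul (((v : ℝ) - u) / ((t : ℝ) - s))
  refine (ae_eq_condExp_of_forall_setIntegral_eq hm (hint u v) (fun _ _ _ ↦ hint'.integrableOn)
    (fun A hA _ ↦ ?_) (hmD.const_mul _).stronglyMeasurable.aestronglyMeasurable).symm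
  obtain ⟨A', hA', hAA'⟩ := hle A hA
  rw [setIntegral_congr_set hAA', setIntegral_congr_set hAA']
  have := hξ.setIntegral_pastFutureIncrementSigma_eq_zero hξ_int hst hsu huv hvt hA'
  rw [integral_sub (hint u v).integrableOn hint'.integrableOn] at this
  linarith

/-- Values are recovered from increments by summing from time 0. As ξ_0 = 0 holds only almost
surely, the inclusion is into the completion. -/
lemma pastFutureSigma_le_eventuallyMeasurableSpace (hξ : IsLevyProcess ξ P) (s t : ℝ≥0) :
    pastFutureSigma ξ s t
      ≤ eventuallyMeasurableSpace (pastFutureIncrementSigma ξ s t) (ae P) := by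
  have h1 : Measurable[pastFutureIncrementSigma ξ s t] fun ω ↦ ξ t ω - ξ s ω :=
    (comap_measurable _).mono (le_sup_right.trans le_sup_left) le_rfl
  have h2 : ∀ u ≤ s, Measurable[pastFutureIncrementSigma ξ s t] fun ω ↦ ξ u ω - ξ 0 ω :=
    fun u hu ↦ (measurable_incrementSigma (S := Iic s) (mem_Iic.2 zero_le) hu).mono
      (le_sup_left.trans le_sup_left) le_rfl
  have h3 : ∀ u ≥ t, Measurable[pastFutureIncrementSigma ξ s t] fun ω ↦ ξ u ω - ξ t ω :=
    fun u hu ↦ (measurable_incrementSigma (S := Ici t) (mem_Ici.2 le_rfl) hu).mono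
      le_sup_right le_rfl
  refine iSup₂_le fun u hu ↦ measurable_iff_comap_le.1 ?_
  have h4 : Measurable[pastFutureIncrementSigma ξ s t] fun ω ↦ ξ u ω - ξ 0 ω := by
    rcases hu with hu | hu
    · exact h2 u hu
    · simpa [Pi.add_def] using ((h3 u hu).add h1).add (h2 s le_rfl)
  refine h4.eventuallyMeasurable_of_eventuallyEq ?_
  filter_upwards [hξ.zero] with ω hω
  rw [hω, sub_zero]

lemma naturalPastFuture_le_eventuallyMeasurableSpace (hξ : IsLevyProcess ξ P) (s t : ℝ≥0) :
    (naturalPastFuture ξ hξ.measurable P).sigma s t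
      ≤ eventuallyMeasurableSpace (pastFutureIncrementSigma ξ s t) (ae P) := by
  refine sup_le (hξ.pastFutureSigma_le_eventuallyMeasurableSpace s t)
    (MeasurableSpace.generateFrom_le fun A hA ↦ 
      ⟨∅, @MeasurableSet.empty _ (pastFutureIncrementSigma ξ s t), ?_⟩)
  exact ae_eq_empty.2 hA.2

end IsLevyProcess

/-! ### Limits in probability -/

section LimInProb

variable {Ω ι : Type*} {mΩ : MeasurableSpace Ω} {P : Measure Ω} {F : ι → Ω → ℝ} {l : Filter ι}
  {g : Ω → ℝ}

lemma measurable_limInProb : Measurable (limInProb F l P) := by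
  unfold limInProb
  split_ifs with h
  · exact h.choose_spec.1
  · exact measurable_zero

lemma ConvergesInProb.tendstoInMeasure_limInProb (h : ConvergesInProb F l P) :
    TendstoInMeasure P F l (limInProb F l P) := by
  rw [limInProb, dif_pos h]
  exact h.choose_spec.2

lemma MeasureTheory.TendstoInMeasure.convergesInProb (h : TendstoInMeasure P F l g)
    (hg : AEMeasurable g P) : ConvergesInProb F l P :=
  ⟨hg.mk g, hg.measurable_mk, h.congr_right hg.ae_eq_mk⟩

lemma MeasureTheory.TendstoInMeasure.limInProb_ae_eq [l.NeBot] [l.IsCountablyGenerated]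
    (h : TendstoInMeasure P F l g) (hg : AEMeasurable g P) : limInProb F l P =ᵐ[P] g :=
  tendstoInMeasure_ae_unique (h.convergesInProb hg).tendstoInMeasure_limInProb h

lemma MeasureTheory.TendstoInMeasure.sub_const (h : TendstoInMeasure P F l g) (c : Ω → ℝ) :
    TendstoInMeasure P (fun i ↦ F i - c) l (g - c) := by
  intro ε hε
  simpa only [Pi.sub_apply, edist_sub_right] using h ε hε

/-- A subsequence converges almost surely, and the pointwise limit of `m`-measurable versions is an
`m`-measurable version of g. -/
lemma MeasureTheory.TendstoInMeasure.aestronglyMeasurable_of_forall [l.NeBot]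
    [l.IsCountablyGenerated] {m : MeasurableSpace Ω} (h : TendstoInMeasure P F l g)
    (hF : ∀ i, AEStronglyMeasurable[m] (F i) P) : AEStronglyMeasurable[m] g P := by
  obtain ⟨ns, -, hns⟩ := h.exists_seq_tendsto_ae'
  choose G hG hFG using fun i ↦ hF (ns i)
  refine ⟨fun ω ↦ limUnder atTop fun i ↦ G i ω, ?_, ?_⟩
  · exact StronglyMeasurable.limUnder hG
  · filter_upwards [hns, ae_all_iff.2 hFG] with ω h1 h2
    simp_rw [h2] at h1
    exact h1.limUnder_eq.symm

end LimInProb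

/-- If `Y` agrees almost surely with an `m`-measurable function and `m` contains the null events,
then `Y` is `m`-measurable. -/
lemma Measurable.of_ae_eq_of_null {Ω : Type*} {m mΩ : MeasurableSpace Ω} {P : Measure Ω}
    (hle : m ≤ mΩ) (hnull : ∀ N, MeasurableSet N → P N = 0 → MeasurableSet[m] N)
    {Y Z : Ω → ℝ} (hY : Measurable Y) (hZ : Measurable[m] Z) (hYZ : Y =ᵐ[P] Z) :
    Measurable[m] Y := by
  have hD : MeasurableSet {ω | Y ω ≠ Z ω} :=
    (measurableSet_eq_fun hY (hZ.mono hle le_rfl)).compl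
  have hD0 : P {ω | Y ω ≠ Z ω} = 0 := hYZ
  intro B hB
  have : Y ⁻¹' B = (Z ⁻¹' B \ {ω | Y ω ≠ Z ω}) ∪ (Y ⁻¹' B ∩ {ω | Y ω ≠ Z ω}) := by
    ext ω
    by_cases hω : Y ω = Z ω <;> simp [hω]
  rw [this]
  exact ((hZ hB).diff (hnull _ hD hD0)).union
    (hnull _ ((hY hB).inter hD) (measure_mono_null inter_subset_right hD0))

/-! ### Stochastic integrals and brackets -/

namespace IsLevyProcess

variable {Ω : Type*} {mΩ : MeasurableSpace Ω} {P : Measure Ω} {ξ : ℝ≥0 → Ω → ℝ}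

lemma _root_.coeFn_sum_smul_pathL1_sub (hξ_int : ∀ t, Integrable (ξ t) P) (c : ℕ → ℝ)
    (t : ℕ → ℝ≥0) (n : ℕ) :
    ⇑(∑ i ∈ Finset.range n, c i • (pathL1 hξ_int (t (i + 1)) - pathL1 hξ_int (t i)))
      =ᵐ[P] fun ω ↦ ∑ i ∈ Finset.range n, c i * (ξ (t (i + 1)) ω - ξ (t i) ω) := by
  have h : ∀ i, ⇑(c i • (pathL1 hξ_int (t (i + 1)) - pathL1 hξ_int (t i)))
      =ᵐ[P] fun ω ↦ c i * (ξ (t (i + 1)) ω - ξ (t i) ω) := by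
    intro i
    filter_upwards [Lp.coeFn_smul (c i) (pathL1 hξ_int (t (i + 1)) - pathL1 hξ_int (t i)),
      Lp.coeFn_sub (pathL1 hξ_int (t (i + 1))) (pathL1 hξ_int (t i)),
      (hξ_int (t (i + 1))).coeFn_toL1, (hξ_int (t i)).coeFn_toL1] with ω h1 h2 h3 h4
    rw [h1, Pi.smul_apply, h2, Pi.sub_apply, pathL1, h3, pathL1, h4, smul_eq_mul]
  filter_upwards [Lp.coeFn_fun_finsetSum (Finset.range n)
    (fun i ↦ c i • (pathL1 hξ_int (t (i + 1)) - pathL1 hξ_int (t i))), ae_all_iff.2 h]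
    with ω h1 h2
  rw [h1]
  exact Finset.sum_congr rfl fun i _ ↦ h2 i

lemma measurable_pastFutureProcess (hξ : ∀ t, Measurable (ξ t)) (f : ℝ≥0 → ℝ) (s t : ℝ≥0) :
    Measurable (pastFutureProcess f ξ P s t) :=
  ((((measurable_limInProb).add measurable_limInProb).add
    ((((hξ t).sub (hξ s)).div_const _).mul_const _)).add measurable_limInProb).sub
      measurable_limInProb

variable [IsProbabilityMeasure P]

lemma leftLim_coe_sub (p q : StieltjesFunction ℝ≥0) (x : ℝ≥0) :
    Function.leftLim (⇑p - ⇑q) x = Function.leftLim p x - Function.leftLim q x :=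
  p.mono.leftLim_sub q.mono x

lemma tendstoInMeasure_elementaryIntegral (hξ : IsLevyProcess ξ P)
    (hξ_int : ∀ t, Integrable (ξ t) P) (p q : StieltjesFunction ℝ≥0) (a b : ℝ≥0) :
    TendstoInMeasure P
      (fun π : TimePartition a b ↦ elementaryIntegral (Function.leftLim (⇑p - ⇑q)) ξ π)
      (meshFilter a b) ⇑(stieltjesIntegral p q (pathL1 hξ_int) a b) := by
  refine (tendstoInMeasure_of_tendsto_Lp (tendsto_sum_stieltjesIntegral
    (hξ.uniformContinuous_pathL1 hξ_int) p q a b)).congr_left fun π ↦ ?_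
  refine (coeFn_sum_smul_pathL1_sub hξ_int (fun i ↦ _) π.pt π.N).trans (.of_forall fun ω ↦ ?_)
  simp only [elementaryIntegral, leftLim_coe_sub]

lemma hasStochIntegral (hξ : IsLevyProcess ξ P) (hξ_int : ∀ t, Integrable (ξ t) P)
    (p q : StieltjesFunction ℝ≥0) (a b : ℝ≥0) :
    HasStochIntegral (Function.leftLim (⇑p - ⇑q)) ξ P a b :=
  (hξ.tendstoInMeasure_elementaryIntegral hξ_int p q a b).convergesInProb 
    (Lp.aestronglyMeasurable _).aemeasurable

lemma stochIntegral_ae_eq (hξ : IsLevyProcess ξ P) (hξ_int : ∀ t, Integrable (ξ t) P)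
    (p q : StieltjesFunction ℝ≥0) {a b : ℝ≥0} (hab : a ≤ b) :
    stochIntegral (Function.leftLim (⇑p - ⇑q)) ξ P a b
      =ᵐ[P] ⇑(stieltjesIntegral p q (pathL1 hξ_int) a b) :=
  have := meshFilter_neBot hab
  (hξ.tendstoInMeasure_elementaryIntegral hξ_int p q a b).limInProb_ae_eq 
    (Lp.aestronglyMeasurable _).aemeasurable

lemma integrable_stochIntegral (hξ : IsLevyProcess ξ P) (hξ_int : ∀ t, Integrable (ξ t) P)
    (p q : StieltjesFunction ℝ≥0) {a b : ℝ≥0} (hab : a ≤ b) :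
    Integrable (stochIntegral (Function.leftLim (⇑p - ⇑q)) ξ P a b) P :=
  (L1.integrable_coeFn _).congr (hξ.stochIntegral_ae_eq hξ_int p q hab).symm

lemma stochIntegral_add (hξ : IsLevyProcess ξ P) (hξ_int : ∀ t, Integrable (ξ t) P)
    (p q : StieltjesFunction ℝ≥0) {a b c : ℝ≥0} (hab : a ≤ b) (hbc : b ≤ c) :
    stochIntegral (Function.leftLim (⇑p - ⇑q)) ξ P a b
      + stochIntegral (Function.leftLim (⇑p - ⇑q)) ξ P b c
      =ᵐ[P] stochIntegral (Function.leftLim (⇑p - ⇑q)) ξ P a c := by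
  filter_upwards [hξ.stochIntegral_ae_eq hξ_int p q hab, hξ.stochIntegral_ae_eq hξ_int p q hbc,
    hξ.stochIntegral_ae_eq hξ_int p q (hab.trans hbc),
    Lp.coeFn_add (stieltjesIntegral p q (pathL1 hξ_int) a b)
      (stieltjesIntegral p q (pathL1 hξ_int) b c)] with ω h1 h2 h3 h4
  rw [Pi.add_apply, h1, h2, h3, ← stieltjesIntegral_add
    (hξ.uniformContinuous_pathL1 hξ_int).continuous p q hab hbc]
  exact h4.symm

lemma aestronglyMeasurable_stochIntegral (hξ : IsLevyProcess ξ P)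
    (hξ_int : ∀ t, Integrable (ξ t) P) (p q : StieltjesFunction ℝ≥0) {a b : ℝ≥0} (hab : a ≤ b)
    {m : MeasurableSpace Ω} (hm : ∀ u ∈ Icc a b, Measurable[m] (ξ u)) :
    AEStronglyMeasurable[m] (stochIntegral (Function.leftLim (⇑p - ⇑q)) ξ P a b) P := by
  have := meshFilter_neBot hab
  refine (hξ.hasStochIntegral hξ_int p q a b).tendstoInMeasure_limInProb
    |>.aestronglyMeasurable_of_forall fun π ↦ ?_
  have : Measurable[m] (elementaryIntegral (Function.leftLim (⇑p - ⇑q)) ξ π) := by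
    refine Finset.measurable_fun_sum _ fun i hi ↦ ?_
    have hi := Finset.mem_range.1 hi
    exact ((hm _ ⟨π.le_pt _, π.pt_le hi⟩).sub (hm _ ⟨π.le_pt _, π.pt_le hi.le⟩)).const_mul _
  exact this.stronglyMeasurable.aestronglyMeasurable

lemma tendstoInMeasure_incrementProductSum (hξ : IsLevyProcess ξ P)
    (hξ_int : ∀ t, Integrable (ξ t) P) (p q : StieltjesFunction ℝ≥0) (a b : ℝ≥0) :
    TendstoInMeasure P
      (fun π : TimePartition a b ↦ incrementProductSum ξ (fun u _ ↦ (⇑p - ⇑q) u) π)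
      (meshFilter a b) 0 := by
  refine (tendstoInMeasure_of_tendsto_Lp (tendsto_sum_smul_sub_zero
    (hξ.uniformContinuous_pathL1 hξ_int) p.mono q.mono a b)).congr (fun π ↦ ?_) (Lp.coeFn_zero ..)
  refine (coeFn_sum_smul_pathL1_sub hξ_int (fun i ↦ _) π.pt π.N).trans (.of_forall fun ω ↦ ?_)
  exact Finset.sum_congr rfl fun i _ ↦ mul_comm _ _

lemma hasBracket (hξ : IsLevyProcess ξ P) (hξ_int : ∀ t, Integrable (ξ t) P)
    (p q : StieltjesFunction ℝ≥0) (t : ℝ≥0) :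
    HasBracket ξ (fun u _ ↦ (⇑p - ⇑q) u) P t :=
  (hξ.tendstoInMeasure_incrementProductSum hξ_int p q 0 t).convergesInProb aemeasurable_zero

lemma bracket_ae_eq_zero (hξ : IsLevyProcess ξ P) (hξ_int : ∀ t, Integrable (ξ t) P)
    (p q : StieltjesFunction ℝ≥0) (t : ℝ≥0) :
    bracket ξ (fun u _ ↦ (⇑p - ⇑q) u) P t =ᵐ[P] 0 :=
  have := meshFilter_neBot (zero_le : 0 ≤ t)
  (hξ.tendstoInMeasure_incrementProductSum hξ_int p q 0 t).limInProb_ae_eq aemeasurable_zero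

lemma condExpL1CLM_pathL1_sub (hξ : IsLevyProcess ξ P) (hξ_int : ∀ t, Integrable (ξ t) P)
    {s u v t : ℝ≥0} (hst : s < t) (hsu : s ≤ u) (huv : u ≤ v) (hvt : v ≤ t)
    {m : MeasurableSpace Ω} (hm : m ≤ mΩ) (hmD : Measurable[m] fun ω ↦ ξ t ω - ξ s ω)
    (hle : m ≤ eventuallyMeasurableSpace (pastFutureIncrementSigma ξ s t) (ae P)) :
    condExpL1CLM ℝ hm P (pathL1 hξ_int v - pathL1 hξ_int u)
      = (((v : ℝ) - u) / ((t : ℝ) - s)) • (pathL1 hξ_int t - pathL1 hξ_int s) := by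
  have h1 : ∀ u v, pathL1 hξ_int v - pathL1 hξ_int u
      = ((hξ_int v).sub (hξ_int u)).toL1 (fun ω ↦ ξ v ω - ξ u ω) := fun u v ↦
    (Integrable.toL1_sub _ _ (hξ_int v) (hξ_int u)).symm
  rw [h1, h1]
  refine Lp.ext ((condExp_ae_eq_condExpL1CLM hm ((hξ_int v).sub (hξ_int u))).symm.trans
    ((hξ.condExp_sub_ae_eq hξ_int hst hsu huv hvt hm hmD hle).trans ?_))
  filter_upwards [Lp.coeFn_smul (((v : ℝ) - u) / ((t : ℝ) - s))
    (((hξ_int t).sub (hξ_int s)).toL1 (fun ω ↦ ξ t ω - ξ s ω)),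
    Integrable.coeFn_toL1 (f := fun ω ↦ ξ t ω - ξ s ω) ((hξ_int t).sub (hξ_int s))] with ω h2 h3
  rw [h2, Pi.smul_apply, h3, smul_eq_mul]

lemma tendsto_sum_leftLim_mul_sub (p q : StieltjesFunction ℝ≥0) (a b : ℝ≥0) :
    Tendsto (fun π : TimePartition a b ↦ ∑ i ∈ Finset.range π.N,
        Function.leftLim (⇑p - ⇑q) (π.pt i) * ((π.pt (i + 1) : ℝ) - π.pt i))
      (meshFilter a b) (𝓝 (∫ u in (a : ℝ)..b, (⇑p - ⇑q) u.toNNReal)) := by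
  have h := (p.mono.tendsto_sum_leftLim_mul_sub a b).sub (q.mono.tendsto_sum_leftLim_mul_sub a b)
  rw [← intervalIntegral.integral_sub p.mono.comp_toNNReal.intervalIntegrable
    q.mono.comp_toNNReal.intervalIntegrable] at h
  refine h.congr fun π ↦ ?_
  rw [← Finset.sum_sub_distrib]
  refine Finset.sum_congr rfl fun i _ ↦ ?_
  rw [leftLim_coe_sub, sub_mul]

/-- The projected elementary sums converge both to the projection of the integral, by continuity on
L¹, and to the Riemann integral of f times (ξ_t - ξ_s)/(t - s). -/
lemma condExp_stochIntegral (hξ : IsLevyProcess ξ P) (hξ_int : ∀ t, Integrable (ξ t) P)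
    (p q : StieltjesFunction ℝ≥0) {s t : ℝ≥0} (hst : s < t)
    {m : MeasurableSpace Ω} (hm : m ≤ mΩ) (hmD : Measurable[m] fun ω ↦ ξ t ω - ξ s ω)
    (hle : m ≤ eventuallyMeasurableSpace (pastFutureIncrementSigma ξ s t) (ae P)) :
    P[stochIntegral (Function.leftLim (⇑p - ⇑q)) ξ P s t|m]
      =ᵐ[P] fun ω ↦ (ξ t ω - ξ s ω) / ((t : ℝ) - s)
        * ∫ u in (s : ℝ)..t, (⇑p - ⇑q) u.toNNReal := by
  have := meshFilter_neBot hst.le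
  set I := ∫ u in (s : ℝ)..t, (⇑p - ⇑q) u.toNNReal
  set X := pathL1 hξ_int
  have hT : condExpL1CLM ℝ hm P (stieltjesIntegral p q X s t)
      = (I / ((t : ℝ) - s)) • (X t - X s) := by
    have h1 := ((condExpL1CLM ℝ hm P).continuous.tendsto _).comp
      (tendsto_sum_stieltjesIntegral (hξ.uniformContinuous_pathL1 hξ_int) p q s t)
    have h2 := ((tendsto_sum_leftLim_mul_sub p q s t).div_const ((t : ℝ) - s)).smul_const
      (X t - X s)
    refine tendsto_nhds_unique h1 (h2.congr fun π ↦ ?_)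
    rw [Function.comp_apply, map_sum, Finset.sum_div, Finset.sum_smul]
    refine Finset.sum_congr rfl fun i hi ↦ ?_
    have hi := Finset.mem_range.1 hi
    rw [map_smul, leftLim_coe_sub]
    have h3 := hξ.condExpL1CLM_pathL1_sub hξ_int hst (π.le_pt i) (π.mono i.le_succ) (π.pt_le hi)
      hm hmD hle
    refine Eq.trans ?_ (congrArg (_ • ·) h3.symm)
    rw [smul_smul, mul_div_assoc]
  have hJ := L1.integrable_coeFn (stieltjesIntegral p q X s t)
  refine (condExp_congr_ae (hξ.stochIntegral_ae_eq hξ_int p q hst.le)).trans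
    ((condExp_ae_eq_condExpL1CLM hm hJ).trans ?_)
  rw [Integrable.toL1_coeFn, hT]
  filter_upwards [Lp.coeFn_smul (I / ((t : ℝ) - s)) (X t - X s), Lp.coeFn_sub (X t) (X s),
    (hξ_int t).coeFn_toL1, (hξ_int s).coeFn_toL1] with ω h1 h2 h3 h4
  rw [h1, Pi.smul_apply, h2, Pi.sub_apply, smul_eq_mul]
  change I / ((t : ℝ) - s) * ((hξ_int t).toL1 (ξ t) ω - (hξ_int s).toL1 (ξ s) ω) = _
  rw [h3, h4]
  ring

/-! ### The improper integral -/

/-- For T ≥ t, additivity turns the integral over (t, T] into the one over (0, T] minus a fixed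
random variable. -/
lemma tendstoInMeasure_stochIntegral_atTop (hξ : IsLevyProcess ξ P)
    (hξ_int : ∀ t, Integrable (ξ t) P) (p q : StieltjesFunction ℝ≥0)
    (h : HasStochIntegralInfty (Function.leftLim (⇑p - ⇑q)) ξ P 0) (t : ℝ≥0) :
    TendstoInMeasure P (fun T ↦ stochIntegral (Function.leftLim (⇑p - ⇑q)) ξ P t T) atTop
      (stochIntegralInfty (Function.leftLim (⇑p - ⇑q)) ξ P 0
        - stochIntegral (Function.leftLim (⇑p - ⇑q)) ξ P 0 t) := by
  refine (h.tendstoInMeasure_limInProb.sub_const _).congr' ?_ .rfl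
  filter_upwards [eventually_ge_atTop t] with T hT
  filter_upwards [hξ.stochIntegral_add hξ_int p q zero_le hT] with ω hω
  rw [Pi.sub_apply, ← hω, Pi.add_apply, add_sub_cancel_left]

lemma hasStochIntegralInfty (hξ : IsLevyProcess ξ P)
    (hξ_int : ∀ t, Integrable (ξ t) P) (p q : StieltjesFunction ℝ≥0)
    (h : HasStochIntegralInfty (Function.leftLim (⇑p - ⇑q)) ξ P 0) (t : ℝ≥0) :
    HasStochIntegralInfty (Function.leftLim (⇑p - ⇑q)) ξ P t :=
  (hξ.tendstoInMeasure_stochIntegral_atTop hξ_int p q h t).convergesInProb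
    (measurable_limInProb.sub measurable_limInProb).aemeasurable

lemma stochIntegralInfty_ae_eq (hξ : IsLevyProcess ξ P)
    (hξ_int : ∀ t, Integrable (ξ t) P) (p q : StieltjesFunction ℝ≥0)
    (h : HasStochIntegralInfty (Function.leftLim (⇑p - ⇑q)) ξ P 0) (t : ℝ≥0) :
    stochIntegralInfty (Function.leftLim (⇑p - ⇑q)) ξ P t
      =ᵐ[P] stochIntegralInfty (Function.leftLim (⇑p - ⇑q)) ξ P 0
        - stochIntegral (Function.leftLim (⇑p - ⇑q)) ξ P 0 t :=
  (hξ.tendstoInMeasure_stochIntegral_atTop hξ_int p q h t).limInProb_ae_eq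
    (measurable_limInProb.sub measurable_limInProb).aemeasurable

lemma aestronglyMeasurable_stochIntegralInfty (hξ : IsLevyProcess ξ P)
    (hξ_int : ∀ t, Integrable (ξ t) P) (p q : StieltjesFunction ℝ≥0)
    (h : HasStochIntegralInfty (Function.leftLim (⇑p - ⇑q)) ξ P 0) (t : ℝ≥0)
    {m : MeasurableSpace Ω} (hm : ∀ u, t ≤ u → Measurable[m] (ξ u)) :
    AEStronglyMeasurable[m] (stochIntegralInfty (Function.leftLim (⇑p - ⇑q)) ξ P t) P := by
  have h1 := (hξ.hasStochIntegralInfty hξ_int p q h t).tendstoInMeasure_limInProb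
  -- Measurability with respect to the future is available only for upper limits T ≥ t, so T is
  -- replaced by max t T, which agrees with it eventually.
  have h2 : TendstoInMeasure P
      (fun T ↦ stochIntegral (Function.leftLim (⇑p - ⇑q)) ξ P t (max t T)) atTop
      (stochIntegralInfty (Function.leftLim (⇑p - ⇑q)) ξ P t) := by
    refine h1.congr' ?_ .rfl
    filter_upwards [eventually_ge_atTop t] with T hT
    rw [max_eq_right hT]
  exact h2.aestronglyMeasurable_of_forall fun T ↦
    hξ.aestronglyMeasurable_stochIntegral hξ_int p q (le_max_left _ _) fun u hu ↦ hm u hu.1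

/-! ### The past-future process -/

lemma pastFutureProcess_ae_eq_condExp (hξ : IsLevyProcess ξ P)
    (hξ_int : ∀ t, Integrable (ξ t) P) (p q : StieltjesFunction ℝ≥0)
    (h : HasStochIntegralInfty (Function.leftLim (⇑p - ⇑q)) ξ P 0)
    (h_int : Integrable (stochIntegralInfty (Function.leftLim (⇑p - ⇑q)) ξ P 0) P)
    {s t : ℝ≥0} (hst : s < t) {m : MeasurableSpace Ω} (hm : m ≤ mΩ)
    (hmξ : ∀ u, u ≤ s ∨ t ≤ u → Measurable[m] (ξ u))
    (hle : m ≤ eventuallyMeasurableSpace (pastFutureIncrementSigma ξ s t) (ae P)) :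
    pastFutureProcess (⇑p - ⇑q) ξ P s t
      =ᵐ[P] P[stochIntegralInfty (Function.leftLim (⇑p - ⇑q)) ξ P 0|m] := by
  let g := Function.leftLim (⇑p - ⇑q)
  have hi1 := hξ.integrable_stochIntegral hξ_int p q (zero_le : 0 ≤ s)
  have hi2 := hξ.integrable_stochIntegral hξ_int p q hst.le
  have hi3 : Integrable (stochIntegralInfty g ξ P t) P :=
    (h_int.sub (hξ.integrable_stochIntegral hξ_int p q zero_le)).congr
      (hξ.stochIntegralInfty_ae_eq hξ_int p q h t).symm
  have hmeas : AEStronglyMeasurable[m] (stochIntegral g ξ P 0 s + stochIntegralInfty g ξ P t) P :=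
    (hξ.aestronglyMeasurable_stochIntegral hξ_int p q zero_le fun u hu ↦ hmξ u (.inl hu.2)).add
      (hξ.aestronglyMeasurable_stochIntegralInfty hξ_int p q h t fun u hu ↦ hmξ u (.inr hu))
  have hsplit : stochIntegralInfty g ξ P 0 =ᵐ[P]
      (stochIntegral g ξ P 0 s + stochIntegralInfty g ξ P t) + stochIntegral g ξ P s t := by
    filter_upwards [hξ.stochIntegralInfty_ae_eq hξ_int p q h t,
      hξ.stochIntegral_add hξ_int p q zero_le hst.le] with ω h1 h2
    simp only [Pi.add_apply, Pi.sub_apply] at h1 h2 ⊢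
    linarith
  filter_upwards [condExp_congr_ae (m := m) hsplit, condExp_add (hi1.add hi3) hi2 m,
    condExp_of_aestronglyMeasurable' hm hmeas (hi1.add hi3),
    hξ.condExp_stochIntegral hξ_int p q hst hm ((hmξ t (.inr le_rfl)).sub (hmξ s (.inl le_rfl)))
      hle, hξ.bracket_ae_eq_zero hξ_int p q s, hξ.bracket_ae_eq_zero hξ_int p q t]
    with ω h1 h2 h3 h4 h5 h6
  rw [h1, h2, Pi.add_apply, h3, h4, pastFutureProcess, h5, h6]
  simp [g]

end IsLevyProcess

/-! ### The main theorem. -/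

theorem mainTheorem2 {Ω : Type*} {mΩ : MeasurableSpace Ω} (P : Measure Ω) [IsProbabilityMeasure P]
    (ξ : ℝ≥0 → Ω → ℝ) (hξ : IsLevyProcess ξ P) (hξ_int : ∀ t, Integrable (ξ t) P)
    (f : ℝ≥0 → ℝ) (hf_int : IntegrableOn (fun u : ℝ ↦ f u.toNNReal) (Ici 0))
    (hf_cadlag : IsCadlag f)
    (hf_var : LocallyBoundedVariationOn f Set.univ)
    (h_exists : HasStochIntegralInfty (Function.leftLim f) ξ P 0)
    (h_int : Integrable (stochIntegralInfty (Function.leftLim f) ξ P 0) P) :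
    -- all the integrals and brackets in the definition of the process exist
    (∀ a b, a ≤ b → HasStochIntegral (Function.leftLim f) ξ P a b) ∧
    (∀ t, HasStochIntegralInfty (Function.leftLim f) ξ P t) ∧
    (∀ t, HasBracket ξ (fun u _ ↦ f u) P t) ∧
    -- the process is a past-future martingale
    IsPastFutureMartingale (pastFutureProcess f ξ P) (naturalPastFuture ξ hξ.measurable P) P ∧
    -- and it is the conditional expectation of the integral over the half-line
    ∀ s t, s < t → pastFutureProcess f ξ P s t
      =ᵐ[P] P[stochIntegralInfty (Function.leftLim f) ξ P 0|pastFutureSigma ξ s t] := by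
  obtain ⟨p, q, rfl⟩ := hf_cadlag.exists_stieltjesFunction_sub hf_var
  have hmξ : ∀ s t u, u ≤ s ∨ t ≤ u → Measurable[pastFutureSigma ξ s t] (ξ u) := fun s t u hu ↦
    (comap_measurable (ξ u)).mono (le_biSup (fun u ↦ MeasurableSpace.comap (ξ u) inferInstance)
      (show u ∈ {u | u ≤ s ∨ t ≤ u} from hu)) le_rfl
  have hH : ∀ s t, pastFutureSigma ξ s t ≤ (naturalPastFuture ξ hξ.measurable P).sigma s t :=
    fun s t ↦ le_sup_left
  have hle := (naturalPastFuture ξ hξ.measurable P).le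
  have hM : ∀ s t, s < t → pastFutureProcess (⇑p - ⇑q) ξ P s t
      =ᵐ[P] P[stochIntegralInfty (Function.leftLim (⇑p - ⇑q)) ξ P 0|
        (naturalPastFuture ξ hξ.measurable P).sigma s t] := fun s t hst ↦
    hξ.pastFutureProcess_ae_eq_condExp hξ_int p q h_exists h_int hst (hle s t)
      (fun u hu ↦ (hmξ s t u hu).mono (hH s t) le_rfl)
      (hξ.naturalPastFuture_le_eventuallyMeasurableSpace s t)
  refine ⟨fun a b _ ↦ hξ.hasStochIntegral hξ_int p q a b,
    hξ.hasStochIntegralInfty hξ_int p q h_exists, hξ.hasBracket hξ_int p q,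
    ⟨fun s t hst ↦ integrable_condExp.congr (hM s t hst).symm, fun s t hst ↦ ?_,
      fun r s t u hrs hst htu ↦ ?_⟩, fun s t hst ↦ ?_⟩
  -- The definition asks for genuine measurability of the chosen versions of the integrals and
  -- brackets; the null events in the augmented σ-algebra upgrade almost sure equality to this.
  · exact Measurable.of_ae_eq_of_null (hle s t)
      (fun N hN h0 ↦ (le_sup_right : _ ≤ (naturalPastFuture ξ hξ.measurable P).sigma s t) _
        (MeasurableSpace.measurableSet_generateFrom ⟨hN, h0⟩))
      (IsLevyProcess.measurable_pastFutureProcess hξ.measurable _ s t)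
      stronglyMeasurable_condExp.measurable (hM s t hst)
  · exact (condExp_congr_ae (hM s t hst)).trans ((condExp_condExp_of_le
      ((naturalPastFuture ξ hξ.measurable P).anti hrs.le htu.le) (hle s t)).trans
      (hM r u (hrs.trans (hst.trans htu))).symm)
  · exact hξ.pastFutureProcess_ae_eq_condExp hξ_int p q h_exists h_int hst
      ((hH s t).trans (hle s t)) (hmξ s t)
      (hξ.pastFutureSigma_le_eventuallyMeasurableSpace s t)
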